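/- Let $M$ be a smooth manifold of dimension $2n$ and let $\Gamma$ be a pseudogroup of local diffeomorphisms of $M$, that is, a set of smooth diffeomorphisms between open subsets of $M$ which contains the identity and is closed under composition, inversion, restriction to open subsets and gluing. Let $\Omega^k_\Gamma(M)$ be the space of smooth real $k$-forms $\xi$ on $M$ such that $\xi|_U=\gamma^*(\xi|_{\gamma(U)})$ for every $\gamma\in\Gamma$ with domain $U$, and let $H^k_\Gamma(M)$ be the $k$-th cohomology of the complex $(\Omega^*_\Gamma(M),d)$. Let $\omega\in\Omega^2_\Gamma(M)$ be a $\Gamma$-invariant symplectic form, i.e. a closed nondegenerate invariant $2$-form. Let $\star\colon\Omega^k_\Gamma(M)\to\Omega^{2n-k}_\Gamma(M)$ be the symplectic star operator: $\star\xi=\iota_X(\omega^n/n!)$, where $X$ is the $k$-vector field that corresponds to $\xi$ under the algebra isomorphism from multivector fields to forms that extends $v\mapsto\iota_v\omega$, and $\iota_{v_1\wedge\dots\wedge v_k}\eta=\eta(v_1,\dots,v_k,\cdot,\dots,\cdot)$. For $\xi\in\Omega^k_\Gamma(M)$ put $\delta\xi=(-1)^k\star d\star\xi$. A form $\xi\in\Omega^k_\Gamma(M)$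 is called harmonic if $d\xi=0$ and $\delta\xi=0$. Let $L\colon H^p_\Gamma(M)\to H^{p+2}_\Gamma(M)$ be the map $L[\xi]=[\omega\wedge\xi]$. Then the following conditions are equivalent: 1. for every $k\ge 0$, every class in $H^k_\Gamma(M)$ is represented by a harmonic form in $\Omega^k_\Gamma(M)$; 2. for every $k\in\{0,1,\dots,n\}$ the map $L^k\colon H^{n-k}_\Gamma(M)\to H^{n+k}_\Gamma(M)$ is surjective. -/

import Mathlib

open scoped Manifold ContDiff

noncomputable section

namespace InvariantForms

open Module

/-! ### Exterior algebra of the dual of a vector space -/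

section Algebra

variable {V W : Type*} [AddCommGroup V] [Module ℝ V] [AddCommGroup W] [Module ℝ W]

/-- Pullback `A^* : Λ(W^*) → Λ(V^*)` of exterior forms along a linear map `A : V → W`. -/
def pullback (A : V →ₗ[ℝ] W) :
    ExteriorAlgebra ℝ (Dual ℝ W) →ₐ[ℝ] ExteriorAlgebra ℝ (Dual ℝ V) :=
  ExteriorAlgebra.map A.dualMap

theorem pullback_mem (A : V →ₗ[ℝ] W) {k : ℕ} {ξ : ExteriorAlgebra ℝ (Dual ℝ W)}
    (hξ : ξ ∈ ⋀[ℝ]^k (Dual ℝ W)) : pullback A ξ ∈ ⋀[ℝ]^k (Dual ℝ V) := by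
  have h := Submodule.mem_map_of_mem (f := (pullback A).toLinearMap) hξ
  rw [Submodule.map_pow] at h
  have hle : (LinearMap.range (ExteriorAlgebra.ι ℝ : Dual ℝ W →ₗ[ℝ] _)).map
      (pullback A).toLinearMap ≤ LinearMap.range (ExteriorAlgebra.ι ℝ) := by
    rintro _ ⟨_, ⟨θ, rfl⟩, rfl⟩
    exact ⟨A.dualMap θ, (ExteriorAlgebra.map_apply_ι _ _).symm⟩
  exact (pow_le_pow_left' hle k : _ ≤ _) h

/-- Interior product `i_v` on `Λ(V^*)`: the antiderivation with `i_v θ = θ(v)` for `θ ∈ V^*`. -/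
def interiorProduct : V →ₗ[ℝ] End ℝ (ExteriorAlgebra ℝ (Dual ℝ V)) :=
  CliffordAlgebra.contractLeft ∘ₗ Dual.eval ℝ V

/-- Contraction of an exterior form by a multivector, normalized by
`i_{v₁ ∧ ⋯ ∧ v_k} = i_{v_k} ∘ ⋯ ∘ i_{v₁}`, that is
`(i_{v₁ ∧ ⋯ ∧ v_k} ξ)(⋯) = ξ(v₁, …, v_k, ⋯)`. -/
def contract (X : ExteriorAlgebra ℝ V) : End ℝ (ExteriorAlgebra ℝ (Dual ℝ V)) :=
  ExteriorAlgebra.lift ℝ ⟨interiorProduct, fun v => LinearMap.ext fun ξ =>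
    CliffordAlgebra.contractLeft_contractLeft (Dual.eval ℝ V v) ξ⟩ (CliffordAlgebra.reverse X)

/-- For `a ∈ Λ²(V^*)`, the map `V → V^*`, `v ↦ i_v a`
(`ιInv` is the projection of `Λ(V^*)` to its degree-one part `V^*`). -/
def flat (a : ExteriorAlgebra ℝ (Dual ℝ V)) : V →ₗ[ℝ] Dual ℝ V :=
  ExteriorAlgebra.ιInv ∘ₗ interiorProduct.flip a

theorem ι_mul_comm_of_mem_two {U : Type*} [AddCommGroup U] [Module ℝ U] (u : U)
    {a : ExteriorAlgebra ℝ U} (ha : a ∈ ⋀[ℝ]^2 U) :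
    ExteriorAlgebra.ι ℝ u * a = a * ExteriorAlgebra.ι ℝ u := by
  have key (x y : U) : ExteriorAlgebra.ι ℝ x * ExteriorAlgebra.ι ℝ y =
      -(ExteriorAlgebra.ι ℝ y * ExteriorAlgebra.ι ℝ x) :=
    eq_neg_of_add_eq_zero_left (ExteriorAlgebra.ι_add_mul_swap x y)
  replace ha : a ∈ LinearMap.range (ExteriorAlgebra.ι ℝ : U →ₗ[ℝ] ExteriorAlgebra ℝ U) *
      LinearMap.range (ExteriorAlgebra.ι ℝ) := pow_two (LinearMap.range
        (ExteriorAlgebra.ι ℝ : U →ₗ[ℝ] ExteriorAlgebra ℝ U)) ▸ ha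
  induction ha using Submodule.mul_induction_on' with
  | mem_mul_mem x hx y hy =>
    obtain ⟨x, rfl⟩ := hx
    obtain ⟨y, rfl⟩ := hy
    rw [← mul_assoc, key u x, neg_mul, mul_assoc, key u y, mul_neg, neg_neg, mul_assoc]
  | add x _ y _ hx hy => rw [mul_add, add_mul, hx, hy]

end Algebra

/-! ### Differential forms on Euclidean space -/

section Euclidean

variable {m : ℕ}

/-- The coordinate covectors `dx^i` on `ℝ^m`. -/
def coordBasis (m : ℕ) : Basis (Fin m) ℝ (Dual ℝ (EuclideanSpace ℝ (Fin m))) :=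
  (EuclideanSpace.basisFun (Fin m) ℝ).toBasis.dualBasis

/-- The basis `dx^I = dx^{i₁} ∧ ⋯ ∧ dx^{i_k}`, `I = {i₁ < ⋯ < i_k}`, of `Λ((ℝ^m)^*)`. -/
def formBasis (m : ℕ) :
    Basis (Finset (Fin m)) ℝ (ExteriorAlgebra ℝ (Dual ℝ (EuclideanSpace ℝ (Fin m)))) :=
  (coordBasis m).ExteriorAlgebra

/-- A form `a = ∑_I a_I dx^I` is smooth on `s` if all the coefficients `a_I` are. -/
def SmoothFormOn
    (a : EuclideanSpace ℝ (Fin m) → ExteriorAlgebra ℝ (Dual ℝ (EuclideanSpace ℝ (Fin m))))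
    (s : Set (EuclideanSpace ℝ (Fin m))) : Prop :=
  ∀ I : Finset (Fin m), ContDiffOn ℝ ∞ (fun y => (formBasis m).coord I (a y)) s

/-- The coefficientwise partial derivative `∂_i a = ∑_I (∂_i a_I) dx^I`. -/
def partialDeriv (i : Fin m)
    (a : EuclideanSpace ℝ (Fin m) → ExteriorAlgebra ℝ (Dual ℝ (EuclideanSpace ℝ (Fin m))))
    (y : EuclideanSpace ℝ (Fin m)) : ExteriorAlgebra ℝ (Dual ℝ (EuclideanSpace ℝ (Fin m))) :=
  ∑ I : Finset (Fin m),
    fderiv ℝ (fun z => (formBasis m).coord I (a z)) y (EuclideanSpace.single i 1) • formBasis m I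

/-- The exterior derivative `d a = ∑_i dx^i ∧ ∂_i a = ∑_{i, I} (∂_i a_I) dx^i ∧ dx^I`. -/
def extDerivEuclidean
    (a : EuclideanSpace ℝ (Fin m) → ExteriorAlgebra ℝ (Dual ℝ (EuclideanSpace ℝ (Fin m))))
    (y : EuclideanSpace ℝ (Fin m)) : ExteriorAlgebra ℝ (Dual ℝ (EuclideanSpace ℝ (Fin m))) :=
  ∑ i : Fin m, ExteriorAlgebra.ι ℝ (coordBasis m i) * partialDeriv i a y

variable
  {a b : EuclideanSpace ℝ (Fin m) → ExteriorAlgebra ℝ (Dual ℝ (EuclideanSpace ℝ (Fin m)))}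
  {y : EuclideanSpace ℝ (Fin m)} {s : Set (EuclideanSpace ℝ (Fin m))}

theorem coord_mul (I : Finset (Fin m))
    (u v : ExteriorAlgebra ℝ (Dual ℝ (EuclideanSpace ℝ (Fin m)))) :
    (formBasis m).coord I (u * v) = ∑ J, ∑ K, (formBasis m).coord J u * (formBasis m).coord K v *
      (formBasis m).coord I (formBasis m J * formBasis m K) := by
  conv_lhs => rw [← (formBasis m).sum_repr u, ← (formBasis m).sum_repr v]
  simp only [Finset.sum_mul, Finset.mul_sum, map_sum, smul_mul_assoc, mul_smul_comm, map_smul,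
    smul_eq_mul, Basis.coord_apply]
  refine (Finset.sum_comm.trans ?_)
  exact Finset.sum_congr rfl fun J _ => Finset.sum_congr rfl fun K _ => by ring

theorem SmoothFormOn.add (ha : SmoothFormOn a s) (hb : SmoothFormOn b s) :
    SmoothFormOn (fun y => a y + b y) s := fun I => by
  simpa only [map_add] using (ha I).add (hb I)

theorem SmoothFormOn.const_smul (c : ℝ) (ha : SmoothFormOn a s) :
    SmoothFormOn (fun y => c • a y) s := fun I => by
  simpa only [map_smul] using (ha I).const_smul c

theorem SmoothFormOn.mul (ha : SmoothFormOn a s) (hb : SmoothFormOn b s) :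
    SmoothFormOn (fun y => a y * b y) s := fun I => by
  simp only [coord_mul I (a _)]
  exact ContDiffOn.sum fun J _ => ContDiffOn.sum fun K _ =>
    ((ha J).mul (hb K)).mul contDiffOn_const

theorem SmoothFormOn.differentiableAt (ha : SmoothFormOn a s) (hs : s ∈ nhds y)
    (I : Finset (Fin m)) : DifferentiableAt ℝ (fun z => (formBasis m).coord I (a z)) y :=
  ((ha I).contDiffAt hs).differentiableAt (by simp)

theorem extDerivEuclidean_add
    (ha : ∀ I, DifferentiableAt ℝ (fun z => (formBasis m).coord I (a z)) y)
    (hb : ∀ I, DifferentiableAt ℝ (fun z => (formBasis m).coord I (b z)) y) :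
    extDerivEuclidean (fun z => a z + b z) y = extDerivEuclidean a y + extDerivEuclidean b y := by
  simp only [extDerivEuclidean, partialDeriv, map_add, ← Finset.sum_add_distrib, ← mul_add,
    ← add_smul]
  refine Finset.sum_congr rfl fun i _ => congrArg _ (Finset.sum_congr rfl fun I _ => ?_)
  rw [fderiv_fun_add (ha I) (hb I), add_apply]

theorem extDerivEuclidean_const_smul (c : ℝ)
    (ha : ∀ I, DifferentiableAt ℝ (fun z => (formBasis m).coord I (a z)) y) :
    extDerivEuclidean (fun z => c • a z) y = c • extDerivEuclidean a y := by
  simp only [extDerivEuclidean, partialDeriv, map_smul, Finset.smul_sum, smul_smul,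
    Finset.mul_sum, mul_smul_comm]
  refine Finset.sum_congr rfl fun i _ => Finset.sum_congr rfl fun I _ => ?_
  rw [fderiv_fun_const_smul (ha I)]
  rfl

theorem partialDeriv_mul (i : Fin m)
    (ha : ∀ I, DifferentiableAt ℝ (fun z => (formBasis m).coord I (a z)) y)
    (hb : ∀ I, DifferentiableAt ℝ (fun z => (formBasis m).coord I (b z)) y) :
    partialDeriv i (fun z => a z * b z) y =
      partialDeriv i a y * b y + a y * partialDeriv i b y := by
  refine (formBasis m).ext_elem fun I => ?_
  have hcoord (c : EuclideanSpace ℝ (Fin m) →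
      ExteriorAlgebra ℝ (Dual ℝ (EuclideanSpace ℝ (Fin m)))) (J : Finset (Fin m)) :
      (formBasis m).coord J (partialDeriv i c y) =
        fderiv ℝ (fun z => (formBasis m).coord J (c z)) y (EuclideanSpace.single i 1) := by
    simp [partialDeriv, Finsupp.single_apply]
  rw [← Basis.coord_apply, ← Basis.coord_apply, map_add, hcoord, coord_mul I (a y),
    coord_mul I _ (b y), ← Finset.sum_add_distrib]
  simp only [coord_mul I (a _), hcoord]
  have h2 (J K : Finset (Fin m)) : HasFDerivAt (fun z => (formBasis m).coord J (a z) *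
      (formBasis m).coord K (b z) * (formBasis m).coord I (formBasis m J * formBasis m K)) _ y :=
    ((ha J).hasFDerivAt.mul (hb K).hasFDerivAt).mul_const _
  rw [(HasFDerivAt.fun_sum fun J _ => HasFDerivAt.fun_sum fun K _ => h2 J K).fderiv]
  simp only [sum_apply, ← Finset.sum_add_distrib]
  refine Finset.sum_congr rfl fun J _ => Finset.sum_congr rfl fun K _ => ?_
  simp
  ring

/-- Leibniz rule for the product with a `2`-form. -/
theorem extDerivEuclidean_mul (ha2 : a y ∈ ⋀[ℝ]^2 (Dual ℝ (EuclideanSpace ℝ (Fin m))))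
    (ha : ∀ I, DifferentiableAt ℝ (fun z => (formBasis m).coord I (a z)) y)
    (hb : ∀ I, DifferentiableAt ℝ (fun z => (formBasis m).coord I (b z)) y) :
    extDerivEuclidean (fun z => a z * b z) y =
      extDerivEuclidean a y * b y + a y * extDerivEuclidean b y := by
  simp only [extDerivEuclidean, Finset.sum_mul, Finset.mul_sum, ← Finset.sum_add_distrib]
  refine Finset.sum_congr rfl fun i _ => ?_
  rw [partialDeriv_mul i ha hb, mul_add, ← mul_assoc, ← mul_assoc, ι_mul_comm_of_mem_two _ ha2,
    mul_assoc (a y)]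

end Euclidean

/-! ### Differential forms on a manifold -/

section Manifold

variable {m : ℕ} {M : Type*} [TopologicalSpace M] [ChartedSpace (EuclideanSpace ℝ (Fin m)) M]

/-- The exterior algebra `Λ(T_x^* M)`. -/
abbrev CotangentAlgebra (m : ℕ) {M : Type*} [TopologicalSpace M]
    [ChartedSpace (EuclideanSpace ℝ (Fin m)) M] (x : M) : Type :=
  ExteriorAlgebra ℝ (Dual ℝ (TangentSpace (𝓡 m) x))

/-- Sections, with no regularity, of the bundle `Λ(T^* M)` over the `m`-dimensional manifold `M`.
The product is the pointwise wedge product. -/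
abbrev Form (m : ℕ) (M : Type*) [TopologicalSpace M]
    [ChartedSpace (EuclideanSpace ℝ (Fin m)) M] : Type _ :=
  ∀ x : M, CotangentAlgebra m x

/-- The differential at `x` of the chart at `x`. -/
def chartDeriv (x : M) : TangentSpace (𝓡 m) x →ₗ[ℝ] EuclideanSpace ℝ (Fin m) :=
  ContinuousLinearMap.toLinearMap (M₂ := EuclideanSpace ℝ (Fin m))
    (mfderiv (𝓡 m) (𝓡 m) (extChartAt (𝓡 m) x) x)

/-- The differential at `y` of the inverse of the chart at `x₀`. -/
def chartSymmDeriv (x₀ : M) (y : EuclideanSpace ℝ (Fin m)) :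
    EuclideanSpace ℝ (Fin m) →ₗ[ℝ] TangentSpace (𝓡 m) ((extChartAt (𝓡 m) x₀).symm y) :=
  ContinuousLinearMap.toLinearMap (M := EuclideanSpace ℝ (Fin m))
    (mfderiv (𝓡 m) (𝓡 m) (extChartAt (𝓡 m) x₀).symm y)

/-- The expression `(φ⁻¹)^* ξ` of the form `ξ` in the chart `φ` at the point `x₀`;
it is meaningful on the target of `φ`. -/
def inChart (x₀ : M) (ξ : Form m M) (y : EuclideanSpace ℝ (Fin m)) :
    ExteriorAlgebra ℝ (Dual ℝ (EuclideanSpace ℝ (Fin m))) :=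
  pullback (chartSymmDeriv x₀ y) (ξ ((extChartAt (𝓡 m) x₀).symm y))

/-- A form is smooth if it is smooth in the charts. -/
def IsSmooth (ξ : Form m M) : Prop :=
  ∀ x₀ : M, SmoothFormOn (inChart x₀ ξ) (extChartAt (𝓡 m) x₀).target

/-- The exterior derivative `dξ = φ^* d((φ⁻¹)^* ξ)`, computed at `x` in the chart `φ` at `x`. -/
def extDerivForm (ξ : Form m M) : Form m M := fun x =>
  pullback (chartDeriv x) (extDerivEuclidean (inChart x ξ) (extChartAt (𝓡 m) x x))

theorem inChart_add (x₀ : M) (ξ η : Form m M) :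
    inChart x₀ (ξ + η) = fun y => inChart x₀ ξ y + inChart x₀ η y :=
  funext fun _ => map_add _ _ _

theorem inChart_smul (x₀ : M) (c : ℝ) (ξ : Form m M) :
    inChart x₀ (c • ξ) = fun y => c • inChart x₀ ξ y :=
  funext fun y => map_smul (pullback (chartSymmDeriv x₀ y)) c _

theorem inChart_mul (x₀ : M) (ξ η : Form m M) :
    inChart x₀ (ξ * η) = fun y => inChart x₀ ξ y * inChart x₀ η y :=
  funext fun _ => map_mul _ _ _

theorem inChart_zero (x₀ : M) : inChart x₀ (0 : Form m M) = fun _ => 0 :=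
  funext fun _ => map_zero _

theorem inChart_mem (x₀ : M) {k : ℕ} {ξ : Form m M}
    (hξ : ∀ x, ξ x ∈ ⋀[ℝ]^k (Dual ℝ (TangentSpace (𝓡 m) x))) (y : EuclideanSpace ℝ (Fin m)) :
    inChart x₀ ξ y ∈ ⋀[ℝ]^k (Dual ℝ (EuclideanSpace ℝ (Fin m))) :=
  pullback_mem _ (hξ _)

theorem pullback_inChart [IsManifold (𝓡 m) ∞ M] (ξ : Form m M) (x : M) :
    pullback (chartDeriv x) (inChart x ξ (extChartAt (𝓡 m) x x)) = ξ x := by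
  have : IsManifold (𝓡 m) 1 M := IsManifold.of_le (n := ∞) (by simp)
  have h1 : chartDeriv x = (LinearMap.id : EuclideanSpace ℝ (Fin m) →ₗ[ℝ] _) :=
    congrArg ContinuousLinearMap.toLinearMap (mfderiv_extChartAt_self (I := 𝓡 m) (x := x))
  have h2 : chartSymmDeriv x (extChartAt (𝓡 m) x x) =
      (LinearMap.id : EuclideanSpace ℝ (Fin m) →ₗ[ℝ] _) := by
    have h := mfderivWithin_range_extChartAt_symm (I := 𝓡 m) (x := x)
    rw [ModelWithCorners.range_eq_univ, mfderivWithin_univ] at h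
    exact congrArg ContinuousLinearMap.toLinearMap h
  have h3 (u : ExteriorAlgebra ℝ (Dual ℝ (EuclideanSpace ℝ (Fin m)))) :
      pullback (LinearMap.id : EuclideanSpace ℝ (Fin m) →ₗ[ℝ] _) u = u := by
    simp [pullback]
  let ξ' : M → ExteriorAlgebra ℝ (Dual ℝ (EuclideanSpace ℝ (Fin m))) := ξ
  have h4 : inChart x ξ (extChartAt (𝓡 m) x x) =
      ξ' ((extChartAt (𝓡 m) x).symm (extChartAt (𝓡 m) x x)) :=
    (congrArg (fun A : EuclideanSpace ℝ (Fin m) →ₗ[ℝ] EuclideanSpace ℝ (Fin m) =>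
      pullback A (ξ' ((extChartAt (𝓡 m) x).symm (extChartAt (𝓡 m) x x)))) h2).trans (h3 _)
  exact ((congrArg (fun A : EuclideanSpace ℝ (Fin m) →ₗ[ℝ] EuclideanSpace ℝ (Fin m) =>
      pullback A (inChart x ξ (extChartAt (𝓡 m) x x))) h1).trans (h3 _)).trans
    (h4.trans (congrArg ξ' (extChartAt_to_inv (I := 𝓡 m) x)))

theorem isSmooth_zero : IsSmooth (0 : Form m M) := fun x₀ I => by
  simp only [inChart_zero, map_zero]
  exact contDiffOn_const

theorem IsSmooth.differentiableAt {ξ : Form m M} (hξ : IsSmooth ξ) (x : M) (I : Finset (Fin m)) :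
    DifferentiableAt ℝ (fun z => (formBasis m).coord I (inChart x ξ z))
      (extChartAt (𝓡 m) x x) :=
  (hξ x).differentiableAt (extChartAt_target_mem_nhds x) I

theorem extDerivForm_zero : extDerivForm (0 : Form m M) = 0 := by
  funext x
  simp [extDerivForm, inChart_zero, extDerivEuclidean, partialDeriv]

theorem extDerivForm_add {ξ η : Form m M} (hξ : IsSmooth ξ) (hη : IsSmooth η) :
    extDerivForm (ξ + η) = extDerivForm ξ + extDerivForm η := by
  funext x
  simp only [extDerivForm, inChart_add, Pi.add_apply]
  rw [extDerivEuclidean_add (hξ.differentiableAt x) (hη.differentiableAt x), map_add]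

theorem extDerivForm_smul (c : ℝ) {ξ : Form m M} (hξ : IsSmooth ξ) :
    extDerivForm (c • ξ) = c • extDerivForm ξ := by
  funext x
  simp only [extDerivForm, inChart_smul, Pi.smul_apply]
  rw [extDerivEuclidean_const_smul c (hξ.differentiableAt x), map_smul]

/-- The space `Ω^k_Γ(M)` of smooth forms of degree `k` with `ξ|_U = γ^*(ξ|_{γ(U)})`
for all `γ ∈ Γ` with domain `U`. -/
def invariantForms (Γ : StructureGroupoid M) (k : ℕ) : Submodule ℝ (Form m M) where
  carrier := {ξ | (∀ x, ξ x ∈ ⋀[ℝ]^k (Dual ℝ (TangentSpace (𝓡 m) x))) ∧ IsSmooth ξ ∧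
    ∀ γ ∈ Γ, ∀ x ∈ γ.source,
      ξ x = pullback (mfderiv (𝓡 m) (𝓡 m) γ x).toLinearMap (ξ (γ x))}
  zero_mem' := ⟨fun _ => zero_mem _, isSmooth_zero, fun _ _ _ _ => (map_zero _).symm⟩
  add_mem' {ξ η} hξ hη := ⟨fun x => add_mem (hξ.1 x) (hη.1 x),
    fun x₀ => inChart_add x₀ ξ η ▸ (hξ.2.1 x₀).add (hη.2.1 x₀), fun γ hγ x hx => by
      simp only [Pi.add_apply, map_add]
      exact congrArg₂ _ (hξ.2.2 γ hγ x hx) (hη.2.2 γ hγ x hx)⟩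
  smul_mem' c ξ hξ := ⟨fun x => Submodule.smul_mem _ c (hξ.1 x),
    fun x₀ => inChart_smul x₀ c ξ ▸ (hξ.2.1 x₀).const_smul c, fun γ hγ x hx => by
      simp only [Pi.smul_apply, map_smul]
      exact congrArg _ (hξ.2.2 γ hγ x hx)⟩

/-- The closed forms in `Ω^k_Γ(M)`. -/
def closedForms (Γ : StructureGroupoid M) (k : ℕ) : Submodule ℝ (Form m M) where
  carrier := {ξ | ξ ∈ invariantForms Γ k ∧ extDerivForm ξ = 0}
  zero_mem' := ⟨zero_mem _, extDerivForm_zero⟩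
  add_mem' {ξ η} hξ hη := ⟨add_mem hξ.1 hη.1, by
    rw [extDerivForm_add hξ.1.2.1 hη.1.2.1, hξ.2, hη.2, add_zero]⟩
  smul_mem' c ξ hξ := ⟨Submodule.smul_mem _ c hξ.1, by
    rw [extDerivForm_smul c hξ.1.2.1, hξ.2, smul_zero]⟩

/-- The forms `dη`, `η ∈ Ω^{k-1}_Γ(M)`; only the zero form if `k = 0`. -/
def exactForms (Γ : StructureGroupoid M) : ℕ → Submodule ℝ (Form m M)
  | 0 => ⊥
  | k + 1 =>
    { carrier := {ξ | ∃ η ∈ invariantForms Γ k, extDerivForm η = ξ}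
      zero_mem' := ⟨0, zero_mem _, extDerivForm_zero⟩
      add_mem' := by
        rintro _ _ ⟨η, hη, rfl⟩ ⟨θ, hθ, rfl⟩
        exact ⟨η + θ, add_mem hη hθ, extDerivForm_add hη.2.1 hθ.2.1⟩
      smul_mem' := by
        rintro c _ ⟨η, hη, rfl⟩
        exact ⟨c • η, Submodule.smul_mem _ c hη, extDerivForm_smul c hη.2.1⟩ }

/-- The `Γ`-invariant cohomology `H^k_Γ(M)`: closed invariant forms modulo the differentials of
invariant forms. -/
abbrev Cohomology (m : ℕ) {M : Type*} [TopologicalSpace M]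
    [ChartedSpace (EuclideanSpace ℝ (Fin m)) M] (Γ : StructureGroupoid M) (k : ℕ) : Type _ :=
  closedForms (m := m) Γ k ⧸ (exactForms (m := m) Γ k).submoduleOf (closedForms Γ k)

/-- The cohomology class of a closed invariant form. -/
def cohomologyClass (Γ : StructureGroupoid M) (k : ℕ) (ξ : closedForms (m := m) Γ k) :
    Cohomology m Γ k :=
  Submodule.Quotient.mk ξ

end Manifold

/-! ### Invariant symplectic forms -/

/-- A `Γ`-invariant symplectic form on the `2n`-dimensional manifold `M`: a closed form
`σ ∈ Ω²_Γ(M)` such that `T_x M → T_x^* M`, `v ↦ i_v σ_x`, is injective for every `x`. -/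
structure SymplecticForm (n : ℕ) {M : Type*} [TopologicalSpace M]
    [ChartedSpace (EuclideanSpace ℝ (Fin (2 * n))) M] (Γ : StructureGroupoid M) where
  form : Form (2 * n) M
  mem_closedForms : form ∈ closedForms Γ 2
  nondegenerate : ∀ x, Function.Injective (flat (form x))

namespace SymplecticForm

variable {n : ℕ} {M : Type*} [TopologicalSpace M]
  [ChartedSpace (EuclideanSpace ℝ (Fin (2 * n))) M] {Γ : StructureGroupoid M}
  (σ : SymplecticForm n Γ)

theorem flat_bijective (x : M) : Function.Bijective (flat (σ.form x)) := by
  have : FiniteDimensional ℝ (TangentSpace (𝓡 (2 * n)) x) :=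
    inferInstanceAs (FiniteDimensional ℝ (EuclideanSpace ℝ (Fin (2 * n))))
  exact ⟨σ.nondegenerate x, (LinearMap.injective_iff_surjective_of_finrank_eq_finrank
    (Subspace.dual_finrank_eq (K := ℝ)).symm).1 (σ.nondegenerate x)⟩

/-- The isomorphism `T_x M ≅ T_x^* M`, `v ↦ i_v σ_x`. -/
def flatEquiv (x : M) :
    TangentSpace (𝓡 (2 * n)) x ≃ₗ[ℝ] Dual ℝ (TangentSpace (𝓡 (2 * n)) x) :=
  LinearEquiv.ofBijective (flat (σ.form x)) (σ.flat_bijective x)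

/-- The algebra isomorphism `Λ(T_x^* M) → Λ(T_x M)` from forms to multivectors,
inverse to the extension of `v ↦ i_v σ_x`. -/
def sharp (x : M) :
    CotangentAlgebra (2 * n) x →ₐ[ℝ] ExteriorAlgebra ℝ (TangentSpace (𝓡 (2 * n)) x) :=
  ExteriorAlgebra.map (σ.flatEquiv x).symm.toLinearMap

/-- The symplectic volume form `σ^n / n!`. -/
def volumeForm : Form (2 * n) M :=
  (n.factorial : ℝ)⁻¹ • σ.form ^ n

/-- The symplectic star operator `⋆ξ = i_X (σ^n / n!)`, with `X` the multivector field that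
corresponds to `ξ`. -/
def symplecticStar (ξ : Form (2 * n) M) : Form (2 * n) M := fun x =>
  contract (σ.sharp x (ξ x)) (σ.volumeForm x)

/-- The codifferential `δξ = (-1)^k ⋆ d ⋆ ξ` of a form `ξ` of degree `k`. -/
def codiff (k : ℕ) (ξ : Form (2 * n) M) : Form (2 * n) M :=
  (-1 : ℝ) ^ k • σ.symplecticStar (extDerivForm (σ.symplecticStar ξ))

/-- Harmonic `Γ`-invariant forms of degree `k`. -/
def IsHarmonic (k : ℕ) (ξ : Form (2 * n) M) : Prop :=
  ξ ∈ invariantForms Γ k ∧ extDerivForm ξ = 0 ∧ σ.codiff k ξ = 0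

theorem wedge_mem_invariantForms {k : ℕ} {ξ : Form (2 * n) M} (hξ : ξ ∈ invariantForms Γ k) :
    σ.form * ξ ∈ invariantForms Γ (k + 2) := by
  obtain ⟨h1, h2, h3⟩ := σ.mem_closedForms.1
  refine ⟨fun x => ?_, fun x₀ => inChart_mul x₀ σ.form ξ ▸ (h2 x₀).mul (hξ.2.1 x₀),
    fun γ hγ x hx => ?_⟩
  · rw [add_comm]
    exact SetLike.mul_mem_graded
      (A := fun i => ⋀[ℝ]^i (Dual ℝ (TangentSpace (𝓡 (2 * n)) x))) (h1 x) (hξ.1 x)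
  · simp only [Pi.mul_apply, map_mul]
    exact congrArg₂ _ (h3 γ hγ x hx) (hξ.2.2 γ hγ x hx)

variable [IsManifold (𝓡 (2 * n)) ∞ M]

theorem extDerivForm_wedge {ξ : Form (2 * n) M} (hξ : IsSmooth ξ) :
    extDerivForm (σ.form * ξ) = σ.form * extDerivForm ξ := by
  obtain ⟨⟨h1, h2, -⟩, h4⟩ := σ.mem_closedForms
  funext x
  have hd := congrFun h4 x
  simp only [extDerivForm, inChart_mul, Pi.mul_apply, Pi.zero_apply] at hd ⊢
  rw [extDerivEuclidean_mul (inChart_mem x h1 _) (h2.differentiableAt x) (hξ.differentiableAt x),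
    map_add, map_mul, map_mul, hd, zero_mul, zero_add, pullback_inChart]

/-- Wedge product with `σ` on closed invariant forms. -/
def wedgeClosed (k : ℕ) :
    closedForms (m := 2 * n) Γ k →ₗ[ℝ] closedForms (m := 2 * n) Γ (k + 2) where
  toFun ξ := ⟨σ.form * ξ, σ.wedge_mem_invariantForms ξ.2.1, by
    rw [σ.extDerivForm_wedge ξ.2.1.2.1, ξ.2.2, mul_zero]⟩
  map_add' ξ η := Subtype.ext (mul_add _ _ _)
  map_smul' c ξ := Subtype.ext (mul_smul_comm _ _ _)

theorem wedgeClosed_exact (k : ℕ) :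
    (exactForms (m := 2 * n) Γ k).submoduleOf (closedForms Γ k) ≤
      ((exactForms (m := 2 * n) Γ (k + 2)).submoduleOf (closedForms Γ (k + 2))).comap
        (σ.wedgeClosed k) := by
  rintro ⟨ξ, hξ⟩ h
  cases k with
  | zero =>
    obtain rfl : ξ = 0 := h
    exact ⟨0, zero_mem _, extDerivForm_zero.trans (mul_zero _).symm⟩
  | succ k =>
    obtain ⟨η, hη, rfl : extDerivForm η = ξ⟩ := h
    exact ⟨σ.form * η, σ.wedge_mem_invariantForms hη, σ.extDerivForm_wedge hη.2.1⟩

/-- The operator `L : H^k_Γ(M) → H^{k+2}_Γ(M)`, `L[ξ] = [σ ∧ ξ]`. -/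
def lefschetz (k : ℕ) : Cohomology (2 * n) Γ k →ₗ[ℝ] Cohomology (2 * n) Γ (k + 2) :=
  Submodule.mapQ _ _ (σ.wedgeClosed k) (σ.wedgeClosed_exact k)

/-- The `k`-fold composition `L^k : H^p_Γ(M) → H^{p+2k}_Γ(M)`. -/
def lefschetzIter (p : ℕ) : (k : ℕ) →
    Cohomology (2 * n) Γ p →ₗ[ℝ] Cohomology (2 * n) Γ (p + 2 * k)
  | 0 => LinearMap.id
  | k + 1 => σ.lefschetz (p + 2 * k) ∘ₗ lefschetzIter p k

/-- The operator `L^k : H^p_Γ(M) → H^q_Γ(M)` for `q = p + 2k`. -/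
def lefschetzPow {p q : ℕ} (k : ℕ) (h : p + 2 * k = q) :
    Cohomology (2 * n) Γ p →ₗ[ℝ] Cohomology (2 * n) Γ q :=
  h ▸ σ.lefschetzIter p k

end SymplecticForm

end InvariantForms

end

/-! Let `Λ` be contraction by the bivector field corresponding to `σ`. The relation `[Λ, L] = n - k`
in degree `k` is an `sl₂`-action. Although `Ω_Γ(M)` is infinite-dimensional, its degrees are
bounded, and this suffices for hard Lefschetz on forms: `L^s` is injective on degree `k` if `s ≤ n -
k` and maps onto degree `k` if `s ≤ k - n` (`eq_zero_of_L_pow_eq_zero`, `exists_L_pow_eq`).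

A closed form is harmonic iff `d Λ ξ = 0`, since `δ` is a nonzero multiple of `d Λ` on closed forms
(`exists_codiff_eq_smul`). Indeed `⋆` is, up to sign, `∑ (-1)^r L^{[n-k+r]} Λ^{[r]}` in degree `k`
(`linearStar_eq_weylSum`), `d` passes through this sum because `[Λ, [Λ, d]] = 0`, and `⋆⋆ = 1`. The
vanishing of `[Λ, [Λ, d]]` needs no Darboux coordinates: it has degree `-3` and commutes with `L`,
and hard Lefschetz kills every such operator (`eq_zero_of_commute`).

1 ⇒ 2: harmonic forms are stable under `L` and `Λ`, so hard Lefschetz holds for them too. A harmonic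
form of degree `n + s` is therefore `L^s` of a harmonic, hence closed, form.

2 ⇒ 1: induction on the degree `k = n - s ≤ n`. Surjectivity of `L^{s+2}` on cohomology and hard
Lefschetz on forms alter a closed `x` by an exact form so that it becomes `L b` plus a closed
primitive form, where `b` is closed of degree `k - 2`. Closed primitive forms are harmonic, and `b`
is handled by induction. Classes above the middle degree are images under `L^s` of classes below it.

The geometric part checks that `Ω_Γ(M)` with `L`, `Λ`, `d` meets the axioms `IsLefschetzComplex`. -/

open scoped Manifold ContDiff

noncomputable section

namespace InvariantForms

open Module

/-! ### Lefschetz modules -/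

section Lefschetz

variable {V : Type*} [AddCommGroup V] [Module ℝ V]

/-- Operators `L` and `Λ` of degrees `2` and `-2` on a graded space concentrated in the degrees
`0, …, 2n`, such that `[Λ, L]` is multiplication by `n - k` in degree `k`. -/
structure IsLefschetzModule (n : ℕ) (L Λ : End ℝ V) (A : ℤ → Submodule ℝ V) : Prop where
  L_mem : ∀ {k x}, x ∈ A k → L x ∈ A (k + 2)
  Λ_mem : ∀ {k x}, x ∈ A k → Λ x ∈ A (k - 2)
  comm : ∀ {k x}, x ∈ A k → Λ (L x) = L (Λ x) + ((n : ℝ) - k) • x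
  eq_zero_of_neg : ∀ {k x}, k < 0 → x ∈ A k → x = 0
  eq_zero_of_lt : ∀ {k x}, 2 * (n : ℤ) < k → x ∈ A k → x = 0

namespace IsLefschetzModule

variable {n : ℕ} {L Λ : End ℝ V} {A : ℤ → Submodule ℝ V}

theorem L_pow_mem (hA : IsLefschetzModule n L Λ A) (s : ℕ) {k : ℤ} {x : V} (hx : x ∈ A k) :
    (L ^ s) x ∈ A (k + 2 * s) := by
  induction s with
  | zero => simpa using hx
  | succ s ih =>
    rw [pow_succ', Module.End.mul_apply]
    convert hA.L_mem ih using 2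
    push_cast
    ring

theorem Λ_pow_mem (hA : IsLefschetzModule n L Λ A) (s : ℕ) {k : ℤ} {x : V} (hx : x ∈ A k) :
    (Λ ^ s) x ∈ A (k - 2 * s) := by
  induction s with
  | zero => simpa using hx
  | succ s ih =>
    rw [pow_succ', Module.End.mul_apply]
    convert hA.Λ_mem ih using 2
    push_cast
    ring

/-- Passing `Λ` through `s + 1` factors `L` collects the scalars `n - k - 2i`, `0 ≤ i ≤ s`, which
add up to `(s + 1)(n - k - s)`. -/
theorem Λ_L_pow (hA : IsLefschetzModule n L Λ A) (s : ℕ) {k : ℤ} {x : V} (hx : x ∈ A k) :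
    Λ ((L ^ (s + 1)) x) =
      (L ^ (s + 1)) (Λ x) + (((s : ℝ) + 1) * ((n : ℝ) - k - s)) • (L ^ s) x := by
  induction s with
  | zero => simpa using hA.comm hx
  | succ s ih =>
    rw [pow_succ', Module.End.mul_apply, hA.comm (hA.L_pow_mem (s + 1) hx), ih, map_add, map_smul,
      ← Module.End.mul_apply L, ← Module.End.mul_apply L, ← pow_succ', ← pow_succ']
    push_cast
    module

theorem L_Λ_pow (hA : IsLefschetzModule n L Λ A) (s : ℕ) {k : ℤ} {x : V} (hx : x ∈ A k) :
    L ((Λ ^ (s + 1)) x) =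
      (Λ ^ (s + 1)) (L x) + (((s : ℝ) + 1) * ((k : ℝ) - n - s)) • (Λ ^ s) x := by
  induction s with
  | zero =>
    simp only [zero_add, pow_one, pow_zero, Module.End.one_apply, hA.comm hx]
    push_cast
    module
  | succ s ih =>
    have h := hA.comm (hA.Λ_pow_mem (s + 1) hx)
    rw [pow_succ' Λ (s + 1), Module.End.mul_apply, Module.End.mul_apply,
      ← sub_eq_iff_eq_add.2 h, ih, map_add, map_smul, ← Module.End.mul_apply Λ (Λ ^ s),
      ← pow_succ']
    push_cast
    module

/-- The injective half of hard Lefschetz, by induction on the degree and, inside it, on `s`. The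
constant in `Λ_L_pow` is positive in this range. -/
theorem eq_zero_of_L_pow_eq_zero (hA : IsLefschetzModule n L Λ A) {s : ℕ} {k : ℤ} (hs :
    (s : ℤ) ≤ n - k) {x : V} (hx : x ∈ A k)
    (h : (L ^ s) x = 0) : x = 0 := by
  obtain ⟨N, hN⟩ : ∃ N : ℕ, k < N := ⟨(k + 1).toNat, by omega⟩
  induction N generalizing s k x with
  | zero => exact hA.eq_zero_of_neg (by simpa using hN) hx
  | succ N ihN =>
    induction s with
    | zero => simpa using h
    | succ s ihs =>
      have hc : ((s : ℝ) + 1) * ((n : ℝ) - k - s) ≠ 0 := by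
        have : ((s : ℝ) + 1) ≤ n - k := by exact_mod_cast hs
        have h2 : (0 : ℝ) < (n : ℝ) - k - s := by linarith
        positivity
      have h1 := hA.Λ_L_pow s hx
      rw [h, map_zero] at h1
      -- Applying `L` to `h1` removes the `L^s x` term, so the induction on the degree gives `Λ x =
      -- 0`.
      have h2 : (L ^ (s + 1 + 1)) (Λ x) = 0 := by
        have h3 := congrArg L h1
        rw [map_zero, map_add, map_smul, ← Module.End.mul_apply L, ← Module.End.mul_apply L,
          ← pow_succ', ← pow_succ', h, smul_zero, add_zero] at h3
        exact h3.symm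
      have h4 : Λ x = 0 := ihN (by push_cast at hs ⊢; omega) (hA.Λ_mem hx) h2 (by
        push_cast at hN; omega)
      rw [h4, map_zero, zero_add] at h1
      exact ihs (by push_cast at hs; omega) ((smul_eq_zero.1 h1.symm).resolve_left hc)

/-- By `L_Λ_pow` every step contributes a factor `(s + 1)(k - n - s)`, positive while `s < k - n`;
the other term contains `L x = 0`. -/
theorem exists_L_pow_Λ_pow_eq_smul (hA : IsLefschetzModule n L Λ A) {s : ℕ} {k : ℤ} (hs :
    (s : ℤ) ≤ k - n) {x : V} (hx : x ∈ A k)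
    (h : L x = 0) : ∃ c : ℝ, c ≠ 0 ∧ (L ^ s) ((Λ ^ s) x) = c • x := by
  induction s with
  | zero => exact ⟨1, one_ne_zero, by simp⟩
  | succ s ih =>
    obtain ⟨c, hc, hcx⟩ := ih (by push_cast at hs; omega)
    have h2 : (0 : ℝ) < (k : ℝ) - n - s := by
      have : ((s : ℝ) + 1) ≤ k - n := by exact_mod_cast hs
      linarith
    refine ⟨((s : ℝ) + 1) * ((k : ℝ) - n - s) * c, by positivity, ?_⟩
    rw [pow_succ L, Module.End.mul_apply, hA.L_Λ_pow s hx, h, map_zero, zero_add, map_smul, hcx,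
      smul_smul]

/-- The surjective half of hard Lefschetz, by descending induction on the degree. Writing `L x =
L^{s+1} y` leaves the remainder `x - L^s y` in the kernel of `L`, where `L^s Λ^s` is an invertible
scalar. -/
theorem exists_L_pow_eq (hA : IsLefschetzModule n L Λ A) {s : ℕ} {k : ℤ} (hs : (s : ℤ) ≤ k - n)
    {x : V} (hx : x ∈ A k) :
    ∃ y ∈ A (k - 2 * s), (L ^ s) y = x := by
  obtain ⟨N, hN⟩ : ∃ N : ℕ, 2 * (n : ℤ) < k + N := ⟨(2 * n + 1 - k).toNat, by omega⟩
  induction N generalizing s k x with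
  | zero => exact ⟨0, zero_mem _, by
      rw [map_zero, hA.eq_zero_of_lt (by simpa using hN) hx]⟩
  | succ N ih =>
    obtain ⟨y, hy, hyx⟩ := ih (s := s + 1) (by push_cast; omega) (hA.L_mem hx)
      (by push_cast at hN; omega)
    have hy' : y ∈ A (k - 2 * s) := by convert hy using 2; push_cast; ring
    have hyk : (L ^ s) y ∈ A k := by convert hA.L_pow_mem s hy' using 2; ring
    have hz : L (x - (L ^ s) y) = 0 := by
      rw [map_sub, ← hyx, pow_succ', Module.End.mul_apply, sub_self]
    have hzA : x - (L ^ s) y ∈ A k := sub_mem hx hyk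
    obtain ⟨c, hc, hcz⟩ := hA.exists_L_pow_Λ_pow_eq_smul hs hzA hz
    refine ⟨y + c⁻¹ • (Λ ^ s) (x - (L ^ s) y),
      add_mem hy' (Submodule.smul_mem _ _ (hA.Λ_pow_mem s hzA)), ?_⟩
    rw [map_add, map_smul, hcz, smul_smul, inv_mul_cancel₀ hc, one_smul, add_sub_cancel]

/-- A form of degree at most `n` is primitive, `Λ x = 0`, if `L^{s+1} x = 0`. -/
theorem Λ_eq_zero_of_L_pow_eq_zero (hA : IsLefschetzModule n L Λ A) {s : ℕ} {k : ℤ}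
    (hs : (s : ℤ) = n - k) {x : V} (hx : x ∈ A k) (h : (L ^ (s + 1)) x = 0) : Λ x = 0 := by
  have h1 := hA.Λ_L_pow s hx
  have hc : (n : ℝ) - k - s = 0 := by
    have : (s : ℝ) = n - k := by exact_mod_cast hs
    rw [this, sub_self]
  rw [h, map_zero, hc, mul_zero, zero_smul, add_zero] at h1
  exact hA.eq_zero_of_L_pow_eq_zero (by push_cast; omega) (hA.Λ_mem hx) h1.symm

/-- An operator of degree `-3` commuting with `L` vanishes. -/
theorem eq_zero_of_commute (hA : IsLefschetzModule n L Λ A) {D : V →ₗ[ℝ] V} (hD : ∀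
    {k x}, x ∈ A k → D x ∈ A (k - 3))
    (hDL : ∀ {k x}, x ∈ A k → D (L x) = L (D x)) {k : ℤ} {x : V} (hx : x ∈ A k) : D x = 0 := by
  have hpow (s : ℕ) {k : ℤ} {x : V} (hx : x ∈ A k) : D ((L ^ s) x) = (L ^ s) (D x) := by
    induction s with
    | zero => simp
    | succ s ih =>
      rw [pow_succ', Module.End.mul_apply, hDL (hA.L_pow_mem s hx), ih, Module.End.mul_apply]
  have main : ∀ N : ℕ, ∀ k : ℤ, k < N → k ≤ n → ∀ x ∈ A k, D x = 0 := by
    intro N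
    induction N with
    | zero =>
      intro k hk _ x hx
      rw [hA.eq_zero_of_neg (by simpa using hk) hx, map_zero]
    | succ N ih =>
      intro k hk hkn x hx
      obtain ⟨s, hs⟩ : ∃ s : ℕ, (s : ℤ) = n - k := ⟨(n - k).toNat, by omega⟩
      -- First step of the Lefschetz decomposition: `L^{s+1} x` has degree `n + s + 2`, hence equals
      -- `L^{s+2} y` with `y` of degree `k - 2`, and `x - L y` is primitive.
      obtain ⟨y, hy, hyx⟩ := hA.exists_L_pow_eq (s := s + 2) (by push_cast; omega)
        (hA.L_pow_mem (s + 1) hx)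
      have hy' : y ∈ A (k - 2) := by convert hy using 2; push_cast; ring
      have hz : (L ^ (s + 1)) (x - L y) = 0 := by
        rw [map_sub, ← Module.End.mul_apply, ← pow_succ, hyx, sub_self]
      have hzA : x - L y ∈ A k := sub_mem hx (by convert hA.L_mem hy' using 2; ring)
      -- `D` lowers the degree to `k - 3`, where even `L^{s+3}` is injective, whereas a primitive
      -- element of degree `k` is only killed by `L^{s+1}`.
      have h1 : D (x - L y) = 0 := hA.eq_zero_of_L_pow_eq_zero (s := s + 1)
        (by push_cast; omega) (hD hzA) (by rw [← hpow _ hzA, hz, map_zero])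
      have h2 : D (L y) = 0 := by
        rw [hDL hy', ih (k - 2) (by push_cast at hk; omega) (by omega) y hy', map_zero]
      rw [← sub_add_cancel x (L y), map_add, h1, h2, add_zero]
  rcases le_total k n with h | h
  · exact main (k + 1).toNat k (by omega) h x hx
  · obtain ⟨s, hs⟩ : ∃ s : ℕ, (s : ℤ) = k - n := ⟨(k - n).toNat, by omega⟩
    obtain ⟨y, hy, rfl⟩ := hA.exists_L_pow_eq (s := s) hs.le hx
    rw [hpow s hy, main (k - 2 * s + 1).toNat (k - 2 * s) (by omega) (by omega) y hy, map_zero]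

end IsLefschetzModule

/-! ### Harmonic elements of Lefschetz complexes -/

/-- A Lefschetz module with a differential `d` commuting with `L`. -/
structure IsLefschetzComplex (n : ℕ) (L Λ d : End ℝ V) (A : ℤ → Submodule ℝ V) : Prop
    extends IsLefschetzModule n L Λ A where
  d_mem : ∀ {k x}, x ∈ A k → d x ∈ A (k + 1)
  d_L : ∀ {k x}, x ∈ A k → d (L x) = L (d x)
  d_d : ∀ {k x}, x ∈ A k → d (d x) = 0

/-- The elements `x` of degree `k` with `d x = 0` and `d Λ x = 0`. -/
def harmonicPart (Λ d : End ℝ V) (A : ℤ → Submodule ℝ V) (k : ℤ) : Submodule ℝ V :=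
  A k ⊓ LinearMap.ker d ⊓ LinearMap.ker (d * Λ)

theorem mem_harmonicPart {Λ d : End ℝ V} {A : ℤ → Submodule ℝ V} {k : ℤ} {x : V} :
    x ∈ harmonicPart Λ d A k ↔ x ∈ A k ∧ d x = 0 ∧ d (Λ x) = 0 := by
  simp [harmonicPart, and_assoc]

namespace IsLefschetzComplex

variable {n : ℕ} {L Λ d : End ℝ V} {A : ℤ → Submodule ℝ V}

theorem d_L_pow (hA : IsLefschetzComplex n L Λ d A) (s : ℕ) {k : ℤ} {x : V} (hx : x ∈ A k) :
    d ((L ^ s) x) = (L ^ s) (d x) := by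
  induction s with
  | zero => simp
  | succ s ih =>
    rw [pow_succ', Module.End.mul_apply, hA.d_L (hA.L_pow_mem s hx), ih, Module.End.mul_apply]

/-- `[Λ, [Λ, d]] = 0`. -/
theorem Λ_Λ_d (hA : IsLefschetzComplex n L Λ d A) {k : ℤ} {x : V} (hx : x ∈ A k) :
    Λ (Λ (d x)) - (2 : ℝ) • Λ (d (Λ x)) + d (Λ (Λ x)) = 0 := by
  -- This is `[Λ, [Λ, d]]`, of degree `1 - 4`. By the Jacobi identity `[[Λ, d], L] = [n - k, d] =
  -- -d`, so its commutator with `L` is `[n - k, [Λ, d]] - [Λ, d] = 0`.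
  refine hA.eq_zero_of_commute (D := Λ * Λ * d - (2 : ℝ) • (Λ * d * Λ) + d * Λ * Λ)
    (fun {k x} hx => ?_) (fun {k x} hx => ?_) hx
  · have h1 := hA.Λ_mem (hA.Λ_mem (hA.d_mem hx))
    have h2 := hA.Λ_mem (hA.d_mem (hA.Λ_mem hx))
    have h3 := hA.d_mem (hA.Λ_mem (hA.Λ_mem hx))
    rw [show k + 1 - 2 - 2 = k - 3 by ring] at h1
    rw [show k - 2 + 1 - 2 = k - 3 by ring] at h2
    rw [show k - 2 - 2 + 1 = k - 3 by ring] at h3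
    exact add_mem (sub_mem h1 (Submodule.smul_mem _ _ h2)) h3
  · simp only [LinearMap.add_apply, LinearMap.sub_apply, LinearMap.smul_apply,
      Module.End.mul_apply]
    rw [hA.d_L hx, hA.comm (hA.d_mem hx), hA.comm hx]
    simp only [map_add, map_smul]
    rw [hA.comm (hA.Λ_mem (hA.d_mem hx)), hA.d_L (hA.Λ_mem hx), hA.comm (hA.d_mem (hA.Λ_mem hx)),
      hA.comm (hA.Λ_mem hx)]
    simp only [map_add, map_smul]
    rw [hA.d_L (hA.Λ_mem (hA.Λ_mem hx))]
    push_cast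
    simp only [map_sub, map_smul]
    module

/-- Since `[d, Λ]` commutes with `Λ`, each of the `r + 1` factors contributes the same term, and
`[d, Λ] x = d Λ x` for closed `x`. -/
theorem d_Λ_pow (hA : IsLefschetzComplex n L Λ d A) (r : ℕ) {k : ℤ} {x : V} (hx : x ∈ A k)
    (hd : d x = 0) :
    d ((Λ ^ (r + 1)) x) = ((r : ℝ) + 1) • (Λ ^ r) (d (Λ x)) := by
  have main (r : ℕ) : ∀ {k : ℤ} {x : V}, x ∈ A k →
      d ((Λ ^ (r + 1)) x) = (Λ ^ (r + 1)) (d x) +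
        ((r : ℝ) + 1) • (Λ ^ r) (d (Λ x) - Λ (d x)) := by
    induction r with
    | zero => intro k x hx; simp
    | succ r ih =>
      intro k x hx
      have h := hA.Λ_Λ_d hx
      have h' : d (Λ (Λ x)) - Λ (d (Λ x)) = Λ (d (Λ x) - Λ (d x)) := by
        rw [map_sub, ← sub_eq_zero, ← h]
        module
      rw [pow_succ Λ (r + 1), Module.End.mul_apply, ih (hA.Λ_mem hx), h', Module.End.mul_apply,
        ← Module.End.mul_apply (Λ ^ r), ← pow_succ, map_sub]
      push_cast
      module
  rw [main r hx, hd, map_zero, map_zero, sub_zero, zero_add]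

/-- For harmonic `x`, stability under `L` follows from `d Λ L x = L d Λ x + (n - k) d x`, and
stability under `Λ` from `Λ_Λ_d`, which leaves `d Λ Λ x = 0`. -/
theorem isLefschetzModule_harmonicPart (hA : IsLefschetzComplex n L Λ d A) :
    IsLefschetzModule n L Λ (harmonicPart Λ d A) where
  L_mem {k x} hx := by
    obtain ⟨h1, h2, h3⟩ := mem_harmonicPart.1 hx
    refine mem_harmonicPart.2 ⟨hA.L_mem h1, by rw [hA.d_L h1, h2, map_zero], ?_⟩
    rw [hA.comm h1, map_add, map_smul, h2, smul_zero, add_zero, hA.d_L (hA.Λ_mem h1), h3, map_zero]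
  Λ_mem {k x} hx := by
    obtain ⟨h1, h2, h3⟩ := mem_harmonicPart.1 hx
    refine mem_harmonicPart.2 ⟨hA.Λ_mem h1, h3, ?_⟩
    simpa [h2, h3] using hA.Λ_Λ_d h1
  comm hx := hA.comm (mem_harmonicPart.1 hx).1
  eq_zero_of_neg hk hx := hA.eq_zero_of_neg hk (mem_harmonicPart.1 hx).1
  eq_zero_of_lt hk hx := hA.eq_zero_of_lt hk (mem_harmonicPart.1 hx).1

/-- If all classes of degree `n + s` have harmonic representatives, then `L^s` maps onto them. -/
theorem exists_L_pow_sub_mem_of_harmonic (hA : IsLefschetzComplex n L Λ d A) {s : ℕ} {x : V}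
    (H : ∃ y ∈ harmonicPart Λ d A (n + s), y - x ∈ (A (n + s - 1)).map d) :
    ∃ y ∈ A (n - s), d y = 0 ∧ (L ^ s) y - x ∈ (A (n + s - 1)).map d := by
  obtain ⟨y, hy, hyx⟩ := H
  -- Hard Lefschetz is applied inside the harmonic part, so that the preimage is closed.
  obtain ⟨z, hz, rfl⟩ := hA.isLefschetzModule_harmonicPart.exists_L_pow_eq (s := s)
    (by omega) hy
  obtain ⟨h1, h2, -⟩ := mem_harmonicPart.1 hz
  exact ⟨z, by convert h1 using 2; ring, h2, hyx⟩

theorem L_pow_mem_map_d (hA : IsLefschetzComplex n L Λ d A) (s : ℕ) {k : ℤ} {x : V}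
    (hx : x ∈ (A (k - 1)).map d) :
    (L ^ s) x ∈ (A (k + 2 * s - 1)).map d := by
  obtain ⟨y, hy, rfl⟩ := hx
  refine ⟨(L ^ s) y, ?_, hA.d_L_pow s hy⟩
  rw [show k + 2 * s - 1 = k - 1 + 2 * s by ring]
  exact hA.L_pow_mem s hy

/-- If `L^s : H^{n-s} → H^{n+s}` is surjective for all `s`, then every class has a harmonic
representative. -/
theorem exists_harmonic_of_surjective (hA : IsLefschetzComplex n L Λ d A)
    (H : ∀ s : ℕ, s ≤ n → ∀ x ∈ A (n + s), d x = 0 →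
      ∃ y ∈ A (n - s), d y = 0 ∧ (L ^ s) y - x ∈ (A (n + s - 1)).map d)
    {k : ℤ} {x : V} (hx : x ∈ A k) (hdx : d x = 0) :
    ∃ y ∈ harmonicPart Λ d A k, y - x ∈ (A (k - 1)).map d := by
  have low : ∀ N : ℕ, ∀ k : ℤ, k < N → k ≤ n → ∀ x ∈ A k, d x = 0 →
      ∃ y ∈ harmonicPart Λ d A k, y - x ∈ (A (k - 1)).map d := by
    intro N
    induction N with
    | zero =>
      intro k hk _ x hx _
      obtain rfl := hA.eq_zero_of_neg (by simpa using hk) hx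
      exact ⟨0, zero_mem _, by rw [sub_zero]; exact zero_mem _⟩
    | succ N ih =>
      intro k hk hkn x hx hdx
      obtain ⟨s, hs⟩ : ∃ s : ℕ, (s : ℤ) = n - k := ⟨(n - k).toNat, by omega⟩
      have hkA : A (k + 2 * ↑(s + 1)) = A (n + ↑(s + 2)) := by congr 1; push_cast; omega
      have hLx := hA.L_pow_mem (s + 1) hx
      rw [hkA] at hLx
      have hdLx : d ((L ^ (s + 1)) x) = 0 := by rw [hA.d_L_pow _ hx, hdx, map_zero]
      -- If `s + 2 > n`, the hypothesis says nothing, but then `L^{s+1} x` has degree above `2n` and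
      -- `b = 0` serves.
      obtain ⟨b, hb, hdb, hbx⟩ : ∃ b ∈ A (k - 2), d b = 0 ∧
          (L ^ (s + 2)) b - (L ^ (s + 1)) x ∈ (A (n + ↑(s + 2) - 1)).map d := by
        rcases le_or_gt (s + 2) n with hsn | hsn
        · obtain ⟨b, hb, h⟩ := H (s + 2) hsn _ hLx hdLx
          exact ⟨b, by convert hb using 2; push_cast; omega, h⟩
        · refine ⟨0, zero_mem _, map_zero _, ?_⟩
          rw [hA.eq_zero_of_lt (by push_cast; omega) hLx, map_zero, sub_zero]
          exact zero_mem _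
      obtain ⟨e, he, heq⟩ := hbx
      -- Hard Lefschetz on elements, not on classes, makes the exact error equal to `L^{s+1} d t`;
      -- hence `x - L b + d t` is killed by `L^{s+1}`.
      obtain ⟨t, ht, rfl⟩ := hA.exists_L_pow_eq (s := s + 1) (by push_cast; omega) he
      have ht' : t ∈ A (k - 1) := by convert ht using 2; push_cast; omega
      have hLb : L b ∈ A k := by convert hA.L_mem hb using 2; ring
      have hdt : d t ∈ A k := by convert hA.d_mem ht' using 2; ring
      have hz : x - L b + d t ∈ A k := add_mem (sub_mem hx hLb) hdt
      have hLz : (L ^ (s + 1)) (x - L b + d t) = 0 := by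
        rw [map_add, map_sub, ← hA.d_L_pow _ ht, heq, ← Module.End.mul_apply (L ^ (s + 1)) L,
          ← pow_succ]
        abel
      have hdz : d (x - L b + d t) = 0 := by
        rw [map_add, map_sub, hA.d_d ht, hA.d_L hb, hdb, hdx, map_zero, sub_zero, add_zero]
      -- A closed primitive element is harmonic: `Λ z = 0` gives `d Λ z = 0`.
      have hzh : x - L b + d t ∈ harmonicPart Λ d A k := mem_harmonicPart.2 ⟨hz, hdz, by
        rw [hA.Λ_eq_zero_of_L_pow_eq_zero hs hz hLz, map_zero]⟩
      obtain ⟨h, hh, u, hu, hux⟩ := ih (k - 2) (by push_cast at hk; omega) (by omega) b hb hdb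
      have hLh : L h ∈ harmonicPart Λ d A k := by
        convert hA.isLefschetzModule_harmonicPart.L_mem hh using 2; ring
      -- With `h = b + d u`, the representative is `x + d (t + L u)`.
      refine ⟨x - L b + d t + L h, add_mem hzh hLh, t + L u, add_mem ht' ?_, ?_⟩
      · convert hA.L_mem hu using 2; ring
      · rw [map_add, hA.d_L hu, hux, map_sub]
        abel
  rcases le_or_gt k n with h | h
  · exact low (k + 1).toNat k (by omega) h x hx hdx
  rcases le_or_gt k (2 * n) with h' | h'
  · obtain ⟨s, hs⟩ : ∃ s : ℕ, (s : ℤ) = k - n := ⟨(k - n).toNat, by omega⟩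
    obtain rfl : k = n + s := by omega
    -- Above the middle degree, `x` is cohomologous to `L^s y`; a harmonic representative of `y`
    -- stays harmonic under `L^s`.
    obtain ⟨y, hy, hdy, hyx⟩ := H s (by omega) x hx hdx
    obtain ⟨z, hz, hzy⟩ := low (n - s + 1 : ℤ).toNat (n - s) (by omega) (by omega) y hy hdy
    have h2 : (n : ℤ) - s + 2 * s = n + s := by ring
    refine ⟨(L ^ s) z, ?_, ?_⟩
    · have := hA.isLefschetzModule_harmonicPart.L_pow_mem s hz
      rwa [h2] at this
    · have h1 := hA.L_pow_mem_map_d s hzy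
      rw [h2, map_sub] at h1
      simpa using add_mem h1 hyx
  · obtain rfl := hA.eq_zero_of_lt h' hx
    exact ⟨0, zero_mem _, by rw [sub_zero]; exact zero_mem _⟩

end IsLefschetzComplex

/-! ### Divided powers and the Weyl operator -/

/-- The divided power `T^m / m!`, zero for `m < 0`. -/
def divPow (T : End ℝ V) : ℤ → End ℝ V
  | (m : ℕ) => (m.factorial : ℝ)⁻¹ • T ^ m
  | Int.negSucc _ => 0

theorem divPow_natCast (T : End ℝ V) (m : ℕ) :
    divPow T m = (m.factorial : ℝ)⁻¹ • T ^ m := rfl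

theorem divPow_of_neg (T : End ℝ V) {m : ℤ} (hm : m < 0) : divPow T m = 0 := by
  obtain ⟨j, rfl⟩ := Int.eq_negSucc_of_lt_zero hm
  rfl

theorem divPow_zero (T : End ℝ V) : divPow T 0 = 1 := by
  rw [← Nat.cast_zero, divPow_natCast]; simp

/-- If `[X, T] = Y` commutes with `T`, then `X T^{[m]} = T^{[m]} X + Y T^{[m-1]}`. -/
theorem mul_divPow {X Y T : End ℝ V} (h : X * T = T * X + Y) (hY : Y * T = T * Y) (m : ℤ) :
    X * divPow T m = divPow T m * X + Y * divPow T (m - 1) := by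
  have hpow (m : ℕ) : X * T ^ (m + 1) = T ^ (m + 1) * X + ((m : ℝ) + 1) • (Y * T ^ m) := by
    induction m with
    | zero => simpa using h
    | succ m ih =>
      rw [pow_succ T (m + 1), ← mul_assoc, ih, add_mul, mul_assoc, h, smul_mul_assoc,
        mul_assoc Y, ← pow_succ, mul_add, ← mul_assoc, ← (Commute.pow_right hY (m + 1)).eq]
      push_cast
      module
  rcases lt_or_ge m 0 with hm | hm
  · rw [divPow_of_neg T hm, divPow_of_neg T (by omega)]
    simp
  lift m to ℕ using hm
  cases m with
  | zero =>
    rw [Nat.cast_zero, divPow_zero, divPow_of_neg T (by omega : (0 : ℤ) - 1 < 0)]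
    simp
  | succ m =>
    rw [show ((m + 1 : ℕ) : ℤ) - 1 = m by push_cast; ring, divPow_natCast, divPow_natCast,
      mul_smul_comm, hpow, smul_add, smul_smul, smul_mul_assoc, mul_smul_comm, Nat.factorial_succ]
    congr 2
    have : (m.factorial : ℝ) ≠ 0 := by positivity
    have : (m : ℝ) + 1 ≠ 0 := by positivity
    push_cast
    field_simp

/-- The sum `∑_r (-1)^r L^{[p+r]} Λ^{[r]}`, `0 ≤ r < N`. -/
def weylSum (L Λ : End ℝ V) (N : ℕ) (p : ℤ) : End ℝ V :=
  ∑ r ∈ Finset.range N, (-1 : ℝ) ^ r • (divPow L (p + r) * divPow Λ r)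

theorem weylSum_apply (L Λ : End ℝ V) (N : ℕ) (p : ℤ) (x : V) : weylSum L Λ N p x =
    ∑ r ∈ Finset.range N, (-1 : ℝ) ^ r • divPow L (p + r) (divPow Λ r x) := by
  simp [weylSum]

theorem IsLefschetzModule.divPow_L_mem {n : ℕ} {L Λ : End ℝ V} {A : ℤ → Submodule ℝ V}
    (hA : IsLefschetzModule n L Λ A) (m : ℤ) {k : ℤ} {x : V} (hx : x ∈ A k) :
    divPow L m x ∈ A (k + 2 * m) := by
  rcases lt_or_ge m 0 with hm | hm
  · rw [divPow_of_neg L hm]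
    exact zero_mem _
  lift m to ℕ using hm
  exact Submodule.smul_mem _ _ (hA.L_pow_mem m hx)

theorem IsLefschetzComplex.d_weylSum {n : ℕ} {L Λ d : End ℝ V} {A : ℤ → Submodule ℝ V}
    (hA : IsLefschetzComplex n L Λ d A) (N : ℕ) (p : ℤ) {k : ℤ} (hN : k < 2 * N) {x : V}
    (hx : x ∈ A k) (hdx : d x = 0) :
    d (weylSum L Λ (N + 1) p x) = -weylSum L Λ (N + 1) (p + 1) (d (Λ x)) := by
  have hL (m : ℤ) {k : ℤ} {x : V} (hx : x ∈ A k) : d (divPow L m x) = divPow L m (d x) := by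
    rcases lt_or_ge m 0 with hm | hm
    · rw [divPow_of_neg L hm]
      exact map_zero d
    lift m to ℕ using hm
    simp only [divPow_natCast, LinearMap.smul_apply, map_smul, hA.d_L_pow m hx]
  -- The factor `r + 1` of `d_Λ_pow` is absorbed by the divided power.
  have hΛ (r : ℕ) : d (divPow Λ ↑(r + 1) x) = divPow Λ r (d (Λ x)) := by
    simp only [divPow_natCast, LinearMap.smul_apply, map_smul, hA.d_Λ_pow r hx hdx, smul_smul]
    congr 1
    have : (r.factorial : ℝ) ≠ 0 := by positivity
    have : (r : ℝ) + 1 ≠ 0 := by positivity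
    rw [Nat.factorial_succ]
    push_cast
    field_simp
  have hmem (r : ℕ) : divPow Λ r x ∈ A (k - 2 * r) :=
    Submodule.smul_mem _ _ (hA.Λ_pow_mem r hx)
  -- After the shift of the index by one, the top term on the right has no partner; it vanishes
  -- because its degree `k - 1 - 2N` is negative.
  have hlast : divPow Λ N (d (Λ x)) = 0 := by
    refine hA.eq_zero_of_neg (k := k - 2 + 1 - 2 * N) (by omega)
      (Submodule.smul_mem _ _ (hA.Λ_pow_mem N (hA.d_mem (hA.Λ_mem hx))))
  rw [weylSum_apply, weylSum_apply, Finset.sum_range_succ', Finset.sum_range_succ, hlast,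
    map_zero, smul_zero, add_zero, map_add, map_sum, map_smul, hL _ (hmem 0), Nat.cast_zero,
    divPow_zero, Module.End.one_apply, hdx, map_zero, smul_zero, add_zero, ← Finset.sum_neg_distrib]
  refine Finset.sum_congr rfl fun r _ => ?_
  rw [map_smul, hL _ (hmem (r + 1)), hΛ, pow_succ, mul_neg_one, neg_smul,
    show p + ((r + 1 : ℕ) : ℤ) = p + 1 + r by push_cast; ring]

end Lefschetz

/-! ### Symplectic linear algebra -/

section SymplecticLinear

variable {V W : Type*} [AddCommGroup V] [Module ℝ V] [AddCommGroup W] [Module ℝ W]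

/-- The `k`-th exterior power, zero for `k < 0`. -/
def extGrade (V : Type*) [AddCommGroup V] [Module ℝ V] (k : ℤ) :
    Submodule ℝ (ExteriorAlgebra ℝ V) :=
  if 0 ≤ k then ⋀[ℝ]^k.toNat V else ⊥

theorem extGrade_natCast (k : ℕ) : extGrade V k = ⋀[ℝ]^k V := by
  simp [extGrade]

theorem extGrade_of_neg {k : ℤ} (hk : k < 0) : extGrade V k = ⊥ := if_neg (by omega)

theorem ι_mul_mem_extGrade (u : V) {k : ℤ} {x : ExteriorAlgebra ℝ V} (hx : x ∈ extGrade V k) :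
    ExteriorAlgebra.ι ℝ u * x ∈ extGrade V (k + 1) := by
  rcases lt_or_ge k 0 with hk | hk
  · rw [extGrade_of_neg hk, Submodule.mem_bot] at hx
    rw [hx, mul_zero]
    exact zero_mem _
  lift k to ℕ using hk
  rw [extGrade_natCast] at hx
  rw [← Nat.cast_succ, extGrade_natCast]
  have h := Submodule.mul_mem_mul
    (LinearMap.mem_range_self (ExteriorAlgebra.ι ℝ : V →ₗ[ℝ] _) u) hx
  rwa [← pow_succ'] at h

theorem mul_mem_extGrade {a : ExteriorAlgebra ℝ V} (ha : a ∈ ⋀[ℝ]^2 V) {k : ℤ}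
    {x : ExteriorAlgebra ℝ V} (hx : x ∈ extGrade V k) : a * x ∈ extGrade V (k + 2) := by
  rcases lt_or_ge k 0 with hk | hk
  · rw [extGrade_of_neg hk, Submodule.mem_bot] at hx
    rw [hx, mul_zero]
    exact zero_mem _
  lift k to ℕ using hk
  rw [extGrade_natCast] at hx
  rw [show (k : ℤ) + 2 = ((2 + k : ℕ) : ℤ) by push_cast; ring, extGrade_natCast]
  exact SetLike.mul_mem_graded (A := fun i => ⋀[ℝ]^i V) ha hx

theorem eq_zero_of_mem_extGrade [FiniteDimensional ℝ V] {k : ℤ} (hk : finrank ℝ V < k)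
    {x : ExteriorAlgebra ℝ V} (hx : x ∈ extGrade V k) : x = 0 := by
  lift k to ℕ using by omega
  rw [extGrade_natCast] at hx
  have h : finrank ℝ (⋀[ℝ]^k V) = 0 := by
    rw [exteriorPower.finrank_eq, Nat.choose_eq_zero_of_lt (by exact_mod_cast hk)]
  have := finrank_zero_iff.1 h
  exact congrArg Subtype.val (Subsingleton.elim (⟨x, hx⟩ : ⋀[ℝ]^k V) 0)

theorem ι_mul_comm_of_mem (u : V) {k : ℕ} {x : ExteriorAlgebra ℝ V} (hx : x ∈ ⋀[ℝ]^k V) :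
    ExteriorAlgebra.ι ℝ u * x = (-1 : ℝ) ^ k • (x * ExteriorAlgebra.ι ℝ u) := by
  induction hx using Submodule.pow_induction_on_left' with
  | algebraMap r => simp [Algebra.commutes]
  | add x y i hx hy h1 h2 => rw [mul_add, h1, h2, add_mul, smul_add]
  | mem_mul m hm i x hx ih =>
    obtain ⟨w, rfl⟩ := hm
    have := eq_neg_of_add_eq_zero_left (ExteriorAlgebra.ι_add_mul_swap (R := ℝ) u w)
    rw [← mul_assoc, this, neg_mul, mul_assoc, ih, mul_smul_comm, ← mul_assoc, pow_succ]
    module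

theorem interiorProduct_ι_mul (v : V) (θ : Dual ℝ V) (x : ExteriorAlgebra ℝ (Dual ℝ V)) :
    interiorProduct v (ExteriorAlgebra.ι ℝ θ * x) =
      θ v • x - ExteriorAlgebra.ι ℝ θ * interiorProduct v x :=
  CliffordAlgebra.contractLeft_ι_mul (Dual.eval ℝ V v) θ x

theorem interiorProduct_algebraMap (v : V) (r : ℝ) :
    interiorProduct v (algebraMap ℝ (ExteriorAlgebra ℝ (Dual ℝ V)) r) = 0 :=
  CliffordAlgebra.contractLeft_algebraMap _ (Dual.eval ℝ V v) r

theorem interiorProduct_ι (v : V) (θ : Dual ℝ V) :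
    interiorProduct v (ExteriorAlgebra.ι ℝ θ) = algebraMap ℝ _ (θ v) :=
  CliffordAlgebra.contractLeft_ι _ (Dual.eval ℝ V v) θ

theorem interiorProduct_comm (v w : V) (x : ExteriorAlgebra ℝ (Dual ℝ V)) :
    interiorProduct v (interiorProduct w x) = -interiorProduct w (interiorProduct v x) :=
  CliffordAlgebra.contractLeft_comm (Dual.eval ℝ V v) (Dual.eval ℝ V w) x

theorem interiorProduct_mem (v : V) {k : ℤ} {x : ExteriorAlgebra ℝ (Dual ℝ V)}
    (hx : x ∈ extGrade (Dual ℝ V) k) : interiorProduct v x ∈ extGrade (Dual ℝ V) (k - 1) := by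
  rcases lt_or_ge k 0 with hk | hk
  · rw [extGrade_of_neg hk, Submodule.mem_bot] at hx
    rw [hx, map_zero]
    exact zero_mem _
  lift k to ℕ using hk
  rw [extGrade_natCast] at hx
  induction hx using Submodule.pow_induction_on_left' with
  | algebraMap r => rw [interiorProduct_algebraMap]; exact zero_mem _
  | add x y i hx hy h1 h2 => rw [map_add]; exact add_mem h1 h2
  | mem_mul m hm i x hx ih =>
    obtain ⟨θ, rfl⟩ := hm
    rw [interiorProduct_ι_mul, show ((i.succ : ℕ) : ℤ) - 1 = i by push_cast; ring]
    refine sub_mem (Submodule.smul_mem _ _ (by rwa [extGrade_natCast])) ?_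
    simpa using ι_mul_mem_extGrade θ ih

theorem interiorProduct_mul_ι (v : V) (θ : Dual ℝ V) {k : ℕ} {x : ExteriorAlgebra ℝ (Dual ℝ V)}
    (hx : x ∈ ⋀[ℝ]^k (Dual ℝ V)) : interiorProduct v (x * ExteriorAlgebra.ι ℝ θ) =
      interiorProduct v x * ExteriorAlgebra.ι ℝ θ + ((-1 : ℝ) ^ k * θ v) • x := by
  induction hx using Submodule.pow_induction_on_left' with
  | algebraMap r =>
    rw [Algebra.commutes, interiorProduct_ι_mul, interiorProduct_algebraMap]
    simp
  | add x y i hx hy h1 h2 => rw [add_mul, map_add, h1, h2, map_add]; simp only [add_mul]; module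
  | mem_mul m hm i x hx ih =>
    obtain ⟨η, rfl⟩ := hm
    rw [mul_assoc, interiorProduct_ι_mul, ih, interiorProduct_ι_mul, sub_mul, mul_add,
      smul_mul_assoc, mul_smul_comm, mul_assoc, pow_succ]
    module

/-- `i_v` is a derivation on products with a `2`-form. -/
theorem interiorProduct_mul (v : V) {a : ExteriorAlgebra ℝ (Dual ℝ V)}
    (ha : a ∈ ⋀[ℝ]^2 (Dual ℝ V)) (x : ExteriorAlgebra ℝ (Dual ℝ V)) :
    interiorProduct v (a * x) = interiorProduct v a * x + a * interiorProduct v x := by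
  replace ha : a ∈ LinearMap.range (ExteriorAlgebra.ι ℝ : Dual ℝ V →ₗ[ℝ] _) *
      LinearMap.range (ExteriorAlgebra.ι ℝ) := pow_two (LinearMap.range
        (ExteriorAlgebra.ι ℝ : Dual ℝ V →ₗ[ℝ] _)) ▸ ha
  induction ha using Submodule.mul_induction_on' with
  | mem_mul_mem α hα β hβ =>
    obtain ⟨α, rfl⟩ := hα
    obtain ⟨β, rfl⟩ := hβ
    rw [mul_assoc, interiorProduct_ι_mul, interiorProduct_ι_mul, interiorProduct_ι_mul,
      interiorProduct_ι, sub_mul, mul_sub, smul_mul_assoc, mul_smul_comm, ← Algebra.commutes,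
      mul_assoc, ← Algebra.smul_def, mul_assoc]
    abel
  | add α _ β _ hα hβ => simp only [add_mul, map_add, hα, hβ]; abel

theorem ι_flat (v : V) {a : ExteriorAlgebra ℝ (Dual ℝ V)} (ha : a ∈ ⋀[ℝ]^2 (Dual ℝ V)) :
    ExteriorAlgebra.ι ℝ (flat a v) = interiorProduct v a := by
  have h := interiorProduct_mem v (k := 2) (x := a) (by
    rw [show (2 : ℤ) = ((2 : ℕ) : ℤ) from rfl, extGrade_natCast]; exact ha)
  rw [show (2 : ℤ) - 1 = ((1 : ℕ) : ℤ) from rfl, extGrade_natCast] at h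
  obtain ⟨θ, hθ⟩ : interiorProduct v a ∈ LinearMap.range (ExteriorAlgebra.ι ℝ) :=
    pow_one (LinearMap.range (ExteriorAlgebra.ι ℝ : Dual ℝ V →ₗ[ℝ] _)) ▸ h
  have : flat a v = ExteriorAlgebra.ιInv (interiorProduct v a) := rfl
  rw [this, ← hθ, ExteriorAlgebra.ι_leftInverse]

/-- `∑_i θ_i ∧ i_{v_i}` is multiplication by the degree if `(v_i)`, `(θ_i)` are dual. -/
theorem sum_ι_mul_interiorProduct {I : Type*} [Fintype I] {v : I → V} {θ : I → Dual ℝ V}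
    (h : ∀ η : Dual ℝ V, ∑ i, η (v i) • θ i = η) {k : ℕ} {x : ExteriorAlgebra ℝ (Dual ℝ V)}
    (hx : x ∈ ⋀[ℝ]^k (Dual ℝ V)) :
    ∑ i, ExteriorAlgebra.ι ℝ (θ i) * interiorProduct (v i) x = (k : ℝ) • x := by
  induction hx using Submodule.pow_induction_on_left' with
  | algebraMap r => simp [interiorProduct_algebraMap]
  | add x y i hx hy h1 h2 => simp only [map_add, mul_add, Finset.sum_add_distrib, h1, h2, smul_add]
  | mem_mul m hm j x hx ih =>
    obtain ⟨η, rfl⟩ := hm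
    have h1 (i : I) :
        ExteriorAlgebra.ι ℝ (θ i) * interiorProduct (v i) (ExteriorAlgebra.ι ℝ η * x) =
        ExteriorAlgebra.ι ℝ (η (v i) • θ i) * x +
        ExteriorAlgebra.ι ℝ η * (ExteriorAlgebra.ι ℝ (θ i) * interiorProduct (v i) x) := by
      rw [interiorProduct_ι_mul, mul_sub, map_smul, smul_mul_assoc, mul_smul_comm, ← mul_assoc,
        ← mul_assoc, eq_neg_of_add_eq_zero_left (ExteriorAlgebra.ι_add_mul_swap (R := ℝ) (θ i) η),
        neg_mul, sub_neg_eq_add]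
    rw [Finset.sum_congr rfl fun i _ => h1 i, Finset.sum_add_distrib, ← Finset.sum_mul,
      ← map_sum, h, ← Finset.mul_sum, ih, mul_smul_comm]
    push_cast
    module

theorem contract_ι (v : V) : contract (ExteriorAlgebra.ι ℝ v) = interiorProduct v := by
  rw [contract]
  erw [CliffordAlgebra.reverse_ι]
  exact ExteriorAlgebra.lift_ι_apply ℝ _ _ v

/-- The reversal in `contract` makes it an antihomomorphism: right factors act last. Inductions
involving the star operator therefore split off factors on the right. -/
theorem contract_mul (X Y : ExteriorAlgebra ℝ V) : contract (X * Y) = contract Y * contract X := by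
  rw [contract]
  erw [CliffordAlgebra.reverse.map_mul]
  exact map_mul _ _ _

theorem contract_algebraMap (r : ℝ) :
    contract (algebraMap ℝ (ExteriorAlgebra ℝ V) r) = algebraMap ℝ _ r := by
  rw [contract]
  erw [CliffordAlgebra.reverse.commutes]
  exact AlgHom.commutes _ r

theorem contract_add (X Y : ExteriorAlgebra ℝ V) : contract (X + Y) = contract X + contract Y := by
  simp only [contract, map_add]

theorem contract_smul (r : ℝ) (X : ExteriorAlgebra ℝ V) : contract (r • X) = r • contract X := by
  simp only [contract, map_smul]

theorem contract_sum {I : Type*} (s : Finset I) (X : I → ExteriorAlgebra ℝ V) :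
    contract (∑ i ∈ s, X i) = ∑ i ∈ s, contract (X i) := by
  simp only [contract, map_sum]

/-- A form `a ∈ Λ²(V^*)` for which `v ↦ i_v a` is the isomorphism `e : V ≃ V^*`. -/
structure IsSymplectic (a : ExteriorAlgebra ℝ (Dual ℝ V)) (e : V ≃ₗ[ℝ] Dual ℝ V) : Prop where
  mem : a ∈ ⋀[ℝ]^2 (Dual ℝ V)
  ι_apply : ∀ v, ExteriorAlgebra.ι ℝ (e v) = interiorProduct v a

/-- Contraction `Λ` by the bivector that corresponds to `a`. -/
def dualLefschetz (a : ExteriorAlgebra ℝ (Dual ℝ V)) (e : V ≃ₗ[ℝ] Dual ℝ V) :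
    End ℝ (ExteriorAlgebra ℝ (Dual ℝ V)) :=
  contract (ExteriorAlgebra.map e.symm.toLinearMap a)

/-- The symplectic star operator `x ↦ i_X (a^n / n!)`, with `X` the multivector corresponding
to `x`. -/
def linearStar (n : ℕ) (a : ExteriorAlgebra ℝ (Dual ℝ V)) (e : V ≃ₗ[ℝ] Dual ℝ V)
    (x : ExteriorAlgebra ℝ (Dual ℝ V)) : ExteriorAlgebra ℝ (Dual ℝ V) :=
  contract (ExteriorAlgebra.map e.symm.toLinearMap x) ((n.factorial : ℝ)⁻¹ • a ^ n)

/-- The sign `(-1)^{k(k-1)/2}`. -/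
def starSign : ℕ → ℝ
  | 0 => 1
  | k + 1 => (-1) ^ k * starSign k

theorem starSign_ne_zero (k : ℕ) : starSign k ≠ 0 := by
  induction k with
  | zero => exact one_ne_zero
  | succ k ih => exact mul_ne_zero (pow_ne_zero _ (by norm_num)) ih

namespace IsSymplectic

variable {a : ExteriorAlgebra ℝ (Dual ℝ V)} {e : V ≃ₗ[ℝ] Dual ℝ V}

/-- Contractions by `v` and `w` anticommute on `a`. -/
theorem apply_apply (h : IsSymplectic a e) (v w : V) : e v w = -e w v := by
  have h1 := interiorProduct_comm w v a
  rw [← h.ι_apply, ← h.ι_apply, interiorProduct_ι, interiorProduct_ι, ← map_neg] at h1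
  exact (ExteriorAlgebra.algebraMap_inj _ _ _).1 h1

theorem apply_symm (h : IsSymplectic a e) (θ η : Dual ℝ V) :
    θ (e.symm η) = -η (e.symm θ) := by
  simpa using h.apply_apply (e.symm θ) (e.symm η)

variable {I : Type*} [Fintype I] (b : Basis I ℝ V)

theorem sum_apply_smul_coord (η : Dual ℝ V) : ∑ i, η (b i) • b.coord i = η := by
  refine b.ext fun j => ?_
  simp

theorem sum_symm_coord (h : IsSymplectic a e) (θ : Dual ℝ V) :
    ∑ i, θ (e.symm (b.coord i)) • b i = -e.symm θ := by
  simp only [h.apply_symm θ, neg_smul, Finset.sum_neg_distrib, Basis.coord_apply, b.sum_repr]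

/-- The operator `∑ b^i ∧ i_{b_i}` multiplies a `2`-form by its degree. -/
theorem two_smul_eq (h : IsSymplectic a e) :
    (2 : ℝ) • a = ∑ i, ExteriorAlgebra.ι ℝ (b.coord i) * ExteriorAlgebra.ι ℝ (e (b i)) := by
  have := sum_ι_mul_interiorProduct (sum_apply_smul_coord b) h.mem
  simp only [h.ι_apply, this, Nat.cast_ofNat]

theorem dualLefschetz_eq (h : IsSymplectic a e) (x : ExteriorAlgebra ℝ (Dual ℝ V)) :
    dualLefschetz a e x = (2 : ℝ)⁻¹ • ∑ i, interiorProduct (b i)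
      (interiorProduct (e.symm (b.coord i)) x) := by
  have h1 : a = (2 : ℝ)⁻¹ • ∑ i, ExteriorAlgebra.ι ℝ (b.coord i) *
      ExteriorAlgebra.ι ℝ (e (b i)) := by
    rw [← h.two_smul_eq b, smul_smul, inv_mul_cancel₀ two_ne_zero, one_smul]
  rw [dualLefschetz]
  conv_lhs => rw [h1]
  simp [contract_smul, contract_sum, contract_mul, contract_ι, LinearMap.sum_apply]

/-- Each of the two mixed terms, where just one of the two contractions hits `θ`, sums to `-i_{e⁻¹θ}
x`; this cancels the factor `1/2`. -/
theorem dualLefschetz_ι_mul [FiniteDimensional ℝ V] (h : IsSymplectic a e) (θ : Dual ℝ V)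
    (x : ExteriorAlgebra ℝ (Dual ℝ V)) :
    dualLefschetz a e (ExteriorAlgebra.ι ℝ θ * x) =
      ExteriorAlgebra.ι ℝ θ * dualLefschetz a e x - interiorProduct (e.symm θ) x := by
  set b := finBasis ℝ V
  have h1 (i) : interiorProduct (b i)
      (interiorProduct (e.symm (b.coord i)) (ExteriorAlgebra.ι ℝ θ * x)) =
      interiorProduct (θ (e.symm (b.coord i)) • b i) x -
      interiorProduct (e.symm (θ (b i) • b.coord i)) x +
      ExteriorAlgebra.ι ℝ θ * interiorProduct (b i) (interiorProduct (e.symm (b.coord i)) x) := by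
    rw [interiorProduct_ι_mul, map_sub, map_smul, interiorProduct_ι_mul]
    simp only [map_smul, LinearMap.smul_apply]
    abel
  rw [h.dualLefschetz_eq b, h.dualLefschetz_eq b, Finset.sum_congr rfl fun i _ => h1 i,
    Finset.sum_add_distrib, Finset.sum_sub_distrib, ← Finset.mul_sum, ← LinearMap.sum_apply,
    ← LinearMap.sum_apply, ← map_sum, ← map_sum, ← map_sum, sum_apply_smul_coord b θ,
    h.sum_symm_coord b, map_neg, LinearMap.neg_apply, mul_smul_comm]
  module

/-- Contracting `a` twice gives `∑ x = 2n x`, and the two mixed terms each give `-k x`, because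
`(b_i), (b^i)` and `(e⁻¹ b^i), (-e b_i)` are both dual pairs. Half the sum is `(n - k) x`. -/
theorem dualLefschetz_mul [FiniteDimensional ℝ V] (h : IsSymplectic a e) {n : ℕ}
    (hn : finrank ℝ V = 2 * n) {k : ℕ} {x : ExteriorAlgebra ℝ (Dual ℝ V)}
    (hx : x ∈ ⋀[ℝ]^k (Dual ℝ V)) :
    dualLefschetz a e (a * x) = a * dualLefschetz a e x + ((n : ℝ) - k) • x := by
  set b := finBasis ℝ V
  have h1 (i) : interiorProduct (b i) (interiorProduct (e.symm (b.coord i)) (a * x)) =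
      x - ExteriorAlgebra.ι ℝ (b.coord i) * interiorProduct (b i) x -
      ExteriorAlgebra.ι ℝ (-e (b i)) * interiorProduct (e.symm (b.coord i)) x +
      a * interiorProduct (b i) (interiorProduct (e.symm (b.coord i)) x) := by
    rw [interiorProduct_mul _ h.mem, map_add, interiorProduct_mul _ h.mem, ← h.ι_apply,
      ← h.ι_apply, interiorProduct_ι_mul, e.apply_symm_apply, Basis.coord_apply, b.repr_self,
      Finsupp.single_eq_same, one_smul, map_neg, neg_mul, sub_neg_eq_add, add_assoc]
  have h2 : ∑ i, ExteriorAlgebra.ι ℝ (-e (b i)) * interiorProduct (e.symm (b.coord i)) x =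
      (k : ℝ) • x := by
    refine sum_ι_mul_interiorProduct (fun η => ?_) hx
    simp only [smul_neg, Finset.sum_neg_distrib, ← map_smul]
    rw [← map_sum, h.sum_symm_coord b, map_neg, neg_neg, e.apply_symm_apply]
  rw [h.dualLefschetz_eq b, h.dualLefschetz_eq b, Finset.sum_congr rfl fun i _ => h1 i,
    Finset.sum_add_distrib, Finset.sum_sub_distrib, Finset.sum_sub_distrib, h2,
    sum_ι_mul_interiorProduct (sum_apply_smul_coord b) hx, ← Finset.mul_sum, mul_smul_comm,
    Finset.sum_const, Finset.card_univ, Fintype.card_fin, ← Nat.cast_smul_eq_nsmul ℝ,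
    show (finrank ℝ V : ℝ) = 2 * n by exact_mod_cast hn]
  module

theorem isLefschetzModule [FiniteDimensional ℝ V] (h : IsSymplectic a e) {n : ℕ}
    (hn : finrank ℝ V = 2 * n) :
    IsLefschetzModule n (LinearMap.mulLeft ℝ a) (dualLefschetz a e) (extGrade (Dual ℝ V)) where
  L_mem hx := mul_mem_extGrade h.mem hx
  Λ_mem {k x} hx := by
    rw [h.dualLefschetz_eq (finBasis ℝ V)]
    refine Submodule.smul_mem _ _ (sum_mem fun i _ => ?_)
    rw [show k - 2 = k - 1 - 1 by ring]
    exact interiorProduct_mem _ (interiorProduct_mem _ hx)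
  comm {k x} hx := by
    rcases lt_or_ge k 0 with hk | hk
    · rw [extGrade_of_neg hk, Submodule.mem_bot] at hx
      simp [hx]
    lift k to ℕ using hk
    rw [extGrade_natCast] at hx
    simpa using h.dualLefschetz_mul hn hx
  eq_zero_of_neg hk hx := by
    rwa [extGrade_of_neg hk, Submodule.mem_bot] at hx
  eq_zero_of_lt hk hx := eq_zero_of_mem_extGrade (by
    rw [Subspace.dual_finrank_eq, hn]; exact_mod_cast hk) hx

/-! ### The symplectic star operator on a vector space -/

variable (n : ℕ)

theorem linearStar_mul_ι (θ : Dual ℝ V) (x : ExteriorAlgebra ℝ (Dual ℝ V)) :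
    linearStar n a e (x * ExteriorAlgebra.ι ℝ θ) =
      interiorProduct (e.symm θ) (linearStar n a e x) := by
  rw [linearStar, linearStar, map_mul, contract_mul, ExteriorAlgebra.map_apply_ι, contract_ι]
  rfl

theorem linearStar_add (x y : ExteriorAlgebra ℝ (Dual ℝ V)) :
    linearStar n a e (x + y) = linearStar n a e x + linearStar n a e y := by
  simp only [linearStar, map_add, contract_add, LinearMap.add_apply]

theorem linearStar_smul (r : ℝ) (x : ExteriorAlgebra ℝ (Dual ℝ V)) :
    linearStar n a e (r • x) = r • linearStar n a e x := by
  rw [linearStar, linearStar, map_smul (ExteriorAlgebra.map _) r, contract_smul,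
    LinearMap.smul_apply]

theorem linearStar_algebraMap (r : ℝ) :
    linearStar n a e (algebraMap ℝ _ r) = r • (n.factorial : ℝ)⁻¹ • a ^ n := by
  rw [linearStar, AlgHom.commutes, contract_algebraMap, Module.algebraMap_end_apply]

theorem linearStar_zero : linearStar n a e 0 = 0 := by
  simpa using linearStar_smul n (a := a) (e := e) 0 0

theorem pow_eq_mulLeft_pow (s : ℕ) : a ^ s = (LinearMap.mulLeft ℝ a ^ s) 1 := by
  rw [LinearMap.pow_mulLeft, LinearMap.mulLeft_apply, mul_one]

theorem pow_mem_extGrade (h : IsSymplectic a e) (s : ℕ) :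
    a ^ s ∈ extGrade (Dual ℝ V) (2 * s) := by
  rw [show (2 : ℤ) * s = ((s * 2 : ℕ) : ℤ) by push_cast; ring, extGrade_natCast, mul_comm]
  have := Submodule.pow_mem_pow _ h.mem s
  rwa [← pow_mul] at this

theorem linearStar_mem (h : IsSymplectic a e) {k : ℕ} {x : ExteriorAlgebra ℝ (Dual ℝ V)}
    (hx : x ∈ ⋀[ℝ]^k (Dual ℝ V)) : linearStar n a e x ∈ extGrade (Dual ℝ V) (2 * n - k) := by
  induction hx using Submodule.pow_induction_on_right' with
  | algebraMap r =>
    rw [linearStar_algebraMap]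
    refine Submodule.smul_mem _ _ (Submodule.smul_mem _ _ ?_)
    simpa using h.pow_mem_extGrade n
  | add x y i hx hy h1 h2 => rw [linearStar_add]; exact add_mem h1 h2
  | mul_mem i x hx ih m hm =>
    obtain ⟨θ, rfl⟩ := hm
    rw [linearStar_mul_ι, show (2 : ℤ) * n - i.succ = 2 * n - i - 1 by push_cast; ring]
    exact interiorProduct_mem _ ih

/-- Dual to `linearStar_mul_ι`, and proved from it by induction on right factors. The start is `e(v)
∧ a^n = 0`, a form of degree `2n + 1`. -/
theorem linearStar_interiorProduct [FiniteDimensional ℝ V] (h : IsSymplectic a e)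
    (hn : finrank ℝ V = 2 * n) (v : V) {k : ℕ} {x : ExteriorAlgebra ℝ (Dual ℝ V)}
    (hx : x ∈ ⋀[ℝ]^k (Dual ℝ V)) : linearStar n a e (interiorProduct v x) =
      (-1 : ℝ) ^ k • (ExteriorAlgebra.ι ℝ (e v) * linearStar n a e x) := by
  induction hx using Submodule.pow_induction_on_right' with
  | algebraMap r =>
    have h1 : ExteriorAlgebra.ι ℝ (e v) * a ^ n = 0 :=
      (h.isLefschetzModule hn).eq_zero_of_lt (by omega)
        (ι_mul_mem_extGrade (e v) (h.pow_mem_extGrade n))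
    rw [interiorProduct_algebraMap, linearStar_zero, linearStar_algebraMap, mul_smul_comm,
      mul_smul_comm, h1, smul_zero, smul_zero, smul_zero]
  | add x y i hx hy h1 h2 => simp only [map_add, linearStar_add, h1, h2, mul_add, smul_add]
  | mul_mem i x hx ih m hm =>
    obtain ⟨θ, rfl⟩ := hm
    rw [interiorProduct_mul_ι v θ hx, linearStar_add, linearStar_smul, linearStar_mul_ι,
      linearStar_mul_ι, ih, map_smul, interiorProduct_ι_mul, h.apply_apply, e.apply_symm_apply,
      pow_succ]
    module

theorem linearStar_pow (s : ℕ) : linearStar n a e (a ^ s) =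
    (dualLefschetz a e ^ s) ((n.factorial : ℝ)⁻¹ • a ^ n) := by
  induction s with
  | zero => simpa using linearStar_algebraMap n (a := a) (e := e) 1
  | succ s ih =>
    rw [pow_succ' (dualLefschetz a e), Module.End.mul_apply, ← ih, pow_succ a, linearStar, map_mul,
      contract_mul]
    rfl

theorem linearStar_volume [FiniteDimensional ℝ V] (h : IsSymplectic a e)
    (hn : finrank ℝ V = 2 * n) : linearStar n a e ((n.factorial : ℝ)⁻¹ • a ^ n) = 1 := by
  have hA := h.isLefschetzModule hn
  have h1 : (1 : ExteriorAlgebra ℝ (Dual ℝ V)) ∈ extGrade (Dual ℝ V) 0 := by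
    simpa using h.pow_mem_extGrade 0
  -- By `Λ_L_pow`, `Λ a^{j+1} = (j + 1)(n - j) a^j`. For `j = n` the product is `(n!)²`, which the
  -- two factors `1/n!` cancel.
  have key (j : ℕ) (hj : j ≤ n) : (dualLefschetz a e ^ j) (a ^ j) =
      ((j.factorial * n.descFactorial j : ℕ) : ℝ) • (1 : ExteriorAlgebra ℝ (Dual ℝ V)) := by
    induction j with
    | zero => simp
    | succ j ih =>
      have h2 := hA.Λ_L_pow j h1
      rw [hA.eq_zero_of_neg (by norm_num) (hA.Λ_mem h1), map_zero, zero_add,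
        ← pow_eq_mulLeft_pow, ← pow_eq_mulLeft_pow] at h2
      rw [pow_succ (dualLefschetz a e), Module.End.mul_apply, h2, map_smul, ih (by omega),
        smul_smul, Nat.descFactorial_succ, Nat.factorial_succ]
      congr 1
      push_cast [Nat.cast_sub (by omega : j ≤ n)]
      ring
  rw [linearStar_smul, linearStar_pow, map_smul, key n le_rfl, smul_smul, smul_smul,
    Nat.descFactorial_self]
  have : (n.factorial : ℝ) ≠ 0 := by positivity
  push_cast
  field_simp
  exact one_smul _ _

/-- Star turns `∧ θ` on the right into a contraction and then back into `θ ∧` on the left; the sign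
`(-1)^{2n-i}` and the sign for moving `θ` to the right cancel. -/
theorem linearStar_linearStar [FiniteDimensional ℝ V] (h : IsSymplectic a e)
    (hn : finrank ℝ V = 2 * n) {k : ℕ} {x : ExteriorAlgebra ℝ (Dual ℝ V)}
    (hx : x ∈ ⋀[ℝ]^k (Dual ℝ V)) : linearStar n a e (linearStar n a e x) = x := by
  induction hx using Submodule.pow_induction_on_right' with
  | algebraMap r =>
    rw [linearStar_algebraMap, linearStar_smul, h.linearStar_volume n hn,
      Algebra.algebraMap_eq_smul_one]
  | add x y i hx hy h1 h2 => simp only [linearStar_add, h1, h2]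
  | mul_mem i x hx ih m hm =>
    obtain ⟨θ, rfl⟩ := hm
    have hm := h.linearStar_mem n hx
    rw [linearStar_mul_ι]
    -- For `i > 2n` the induction hypothesis gives `x = 0`, because `⋆x` has negative degree.
    rcases lt_or_ge (2 * n - i : ℤ) 0 with hi | hi
    · rw [extGrade_of_neg hi, Submodule.mem_bot] at hm
      rw [hm, linearStar_zero] at ih
      rw [hm, map_zero, linearStar_zero, ← ih, zero_mul]
    · obtain ⟨j, hj⟩ : ∃ j, j + i = 2 * n := ⟨2 * n - i, by omega⟩
      rw [show (2 * n - i : ℤ) = j by omega, extGrade_natCast] at hm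
      rw [h.linearStar_interiorProduct n hn _ hm, ih, e.apply_symm_apply, ι_mul_comm_of_mem θ hx,
        smul_smul, ← pow_add, hj, pow_mul, neg_one_sq, one_pow, one_smul]

/-- With `T = θ ∧` and `J = i_{e⁻¹θ}`, the relations `[J, L] = T`, `[T, Λ] = J`, `[T, L] = [J, Λ] =
0` move `J` past `L^{[p+r]}` on the left and `T` past `Λ^{[r]}` on the right. The `T` terms agree
and the `J` terms agree after an index shift. -/
theorem interiorProduct_weylSum [FiniteDimensional ℝ V] (h : IsSymplectic a e)
    (θ : Dual ℝ V) (N : ℕ) (p : ℤ) {x : ExteriorAlgebra ℝ (Dual ℝ V)}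
    (hx : divPow (dualLefschetz a e) N x = 0) :
    interiorProduct (e.symm θ) (weylSum (LinearMap.mulLeft ℝ a) (dualLefschetz a e) (N + 1) p x) =
      weylSum (LinearMap.mulLeft ℝ a) (dualLefschetz a e) (N + 1) (p - 1)
        (ExteriorAlgebra.ι ℝ θ * x) := by
  set L := LinearMap.mulLeft ℝ a
  set Λ := dualLefschetz a e
  set T := LinearMap.mulLeft ℝ (ExteriorAlgebra.ι ℝ θ)
  set J := interiorProduct (e.symm θ)
  have hLT : T * L = L * T := LinearMap.ext fun y => by
    simp [L, T, ← mul_assoc, ι_mul_comm_of_mem_two θ h.mem]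
  have hJL : J * L = L * J + T := LinearMap.ext fun y => by
    simp only [J, L, T, Module.End.mul_apply, LinearMap.mulLeft_apply, LinearMap.add_apply,
      interiorProduct_mul _ h.mem, ← h.ι_apply, e.apply_symm_apply, add_comm]
  have hTΛ : T * Λ = Λ * T + J := LinearMap.ext fun y => by
    simp [T, Λ, J, h.dualLefschetz_ι_mul]
  have hJΛ : J * Λ = Λ * J := LinearMap.ext fun y => by
    simp only [J, Λ, Module.End.mul_apply, h.dualLefschetz_eq (finBasis ℝ V), map_smul, map_sum]
    congr 1
    refine Finset.sum_congr rfl fun i _ => ?_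
    rw [interiorProduct_comm, interiorProduct_comm (e.symm θ), map_neg, neg_neg]
  have hL (m : ℤ) (y) : J (divPow L m y) = divPow L m (J y) + divPow L (m - 1) (T y) := by
    have h1 := LinearMap.congr_fun (mul_divPow hJL hLT m) y
    have h2 := LinearMap.congr_fun (mul_divPow (X := T) (Y := 0) (by simpa using hLT) (by simp)
      (m - 1)) y
    simp only [zero_mul, add_zero] at h2
    exact h1.trans (congrArg (divPow L m (J y) + ·) h2)
  have hΛ (m : ℤ) (y) : divPow Λ m (T y) = T (divPow Λ m y) - J (divPow Λ (m - 1) y) :=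
    eq_sub_of_add_eq (LinearMap.congr_fun (mul_divPow hTΛ hJΛ m) y).symm
  change J _ = weylSum L Λ (N + 1) (p - 1) (T x)
  -- The shift leaves two boundary terms: `r = N` vanishes by `hx`, and `r = 0` because `Λ^{[-1]} =
  -- 0`.
  have h1 : ∑ r ∈ Finset.range (N + 1), (-1 : ℝ) ^ r • divPow L (p + r) (J (divPow Λ r x)) =
      -∑ r ∈ Finset.range (N + 1), (-1 : ℝ) ^ r •
        divPow L (p - 1 + r) (J (divPow Λ (r - 1) x)) := by
    rw [Finset.sum_range_succ, Finset.sum_range_succ', hx,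
      divPow_of_neg Λ (by simp : ((0 : ℕ) : ℤ) - 1 < 0)]
    simp only [map_zero, LinearMap.zero_apply, smul_zero, add_zero]
    rw [← Finset.sum_neg_distrib]
    refine Finset.sum_congr rfl fun r _ => ?_
    rw [show p - 1 + ((r + 1 : ℕ) : ℤ) = p + r by push_cast; ring,
      show ((r + 1 : ℕ) : ℤ) - 1 = r by push_cast; ring, pow_succ]
    module
  have h2 (r : ℕ) : p + r - 1 = p - 1 + r := by ring
  simp only [weylSum_apply, map_sum, map_smul, hL, hΛ, smul_add, Finset.sum_add_distrib, map_sub,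
    smul_sub, Finset.sum_sub_distrib, h1, h2]
  abel

/-- The star operator is, up to sign, `∑_r (-1)^r L^{[n-k+r]} Λ^{[r]}` in degree `k`. -/
theorem linearStar_eq_weylSum [FiniteDimensional ℝ V] (h : IsSymplectic a e)
    (hn : finrank ℝ V = 2 * n) {k : ℕ} (N : ℕ) (hN : k < 2 * N)
    {x : ExteriorAlgebra ℝ (Dual ℝ V)} (hx : x ∈ ⋀[ℝ]^k (Dual ℝ V)) :
    linearStar n a e x = starSign k •
      weylSum (LinearMap.mulLeft ℝ a) (dualLefschetz a e) (N + 1) (n - k) x := by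
  have hA := h.isLefschetzModule hn
  have hΛ {k r : ℕ} (hr : k < 2 * r) {x} (hx : x ∈ ⋀[ℝ]^k (Dual ℝ V)) :
      divPow (dualLefschetz a e) r x = 0 :=
    hA.eq_zero_of_neg (k := k - 2 * r) (by omega)
      (Submodule.smul_mem _ _ (hA.Λ_pow_mem r (by rwa [extGrade_natCast])))
  induction hx using Submodule.pow_induction_on_right' with
  | algebraMap r =>
    -- On scalars every positive power of `Λ` vanishes, so only `L^{[n]}` is left.
    rw [linearStar_algebraMap, weylSum_apply, Finset.sum_range_succ', Finset.sum_eq_zero]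
    · simp only [starSign, pow_zero, Nat.cast_zero, sub_zero, add_zero, zero_add, one_smul,
        divPow_zero, Module.End.one_apply, divPow_natCast, LinearMap.smul_apply,
        Algebra.algebraMap_eq_smul_one, map_smul, ← pow_eq_mulLeft_pow]
    · intro s _
      rw [hΛ (k := 0) (by omega) (Submodule.algebraMap_mem r), map_zero, smul_zero]
  | add x y i hx hy h1 h2 => rw [linearStar_add, h1 hN, h2 hN, map_add, smul_add]
  | mul_mem i x hx ih m hm =>
    obtain ⟨θ, rfl⟩ := hm
    -- Moving `θ` from the left of `x` to the right costs `(-1)^i`, the factor in the recursion for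
    -- `starSign`.
    rw [linearStar_mul_ι, ih (by omega), map_smul,
      h.interiorProduct_weylSum θ N _ (hΛ (by omega) hx), ι_mul_comm_of_mem θ hx, map_smul,
      smul_smul, starSign, mul_comm, show (n : ℤ) - i - 1 = n - i.succ by push_cast; ring]

end IsSymplectic

/-! ### Naturality under linear maps -/

theorem interiorProduct_pullback (A : V →ₗ[ℝ] W) (v : V) (x : ExteriorAlgebra ℝ (Dual ℝ W)) :
    interiorProduct v (pullback A x) = pullback A (interiorProduct (A v) x) := by
  induction x using CliffordAlgebra.left_induction with
  | algebraMap r =>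
    have h1 := interiorProduct_algebraMap (A v) r
    have h2 := interiorProduct_algebraMap v r
    erw [AlgHom.commutes, h1, h2, map_zero]
  | add x y hx hy => simp only [map_add, hx, hy]
  | ι_mul x θ hx =>
    change interiorProduct v (pullback A (ExteriorAlgebra.ι ℝ θ * x)) =
      pullback A (interiorProduct (A v) (ExteriorAlgebra.ι ℝ θ * x))
    rw [map_mul, interiorProduct_ι_mul, pullback, ExteriorAlgebra.map_apply_ι, ← pullback,
      interiorProduct_ι_mul, hx, map_sub, map_smul, map_mul]
    simp only [pullback, ExteriorAlgebra.map_apply_ι]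
    rfl

theorem pullback_comp {U : Type*} [AddCommGroup U] [Module ℝ U] (B : W →ₗ[ℝ] U) (A : V →ₗ[ℝ] W)
    (x : ExteriorAlgebra ℝ (Dual ℝ U)) : pullback (B ∘ₗ A) x = pullback A (pullback B x) := by
  have h : (B ∘ₗ A).dualMap = A.dualMap ∘ₗ B.dualMap := rfl
  rw [pullback, h, ← ExteriorAlgebra.map_comp_map]
  rfl

/-- The formula `dualLefschetz_eq` holds in any basis, so it can be evaluated in bases that
correspond under `A`. -/
theorem IsSymplectic.pullback_dualLefschetz [FiniteDimensional ℝ V] (A : V ≃ₗ[ℝ] W)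
    {a : ExteriorAlgebra ℝ (Dual ℝ W)} {e : W ≃ₗ[ℝ] Dual ℝ W} (h : IsSymplectic a e)
    {e' : V ≃ₗ[ℝ] Dual ℝ V} (h' : IsSymplectic (pullback A.toLinearMap a) e')
    (x : ExteriorAlgebra ℝ (Dual ℝ W)) :
    pullback A.toLinearMap (dualLefschetz a e x) =
      dualLefschetz (pullback A.toLinearMap a) e' (pullback A.toLinearMap x) := by
  set b := finBasis ℝ V
  -- The isomorphism `e'` is determined by its form, because `ι` is injective.
  have he (v : V) : e' v = A.toLinearMap.dualMap (e (A v)) := by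
    apply (ExteriorAlgebra.ι_leftInverse (R := ℝ)).injective
    rw [h'.ι_apply, interiorProduct_pullback, ← ExteriorAlgebra.map_apply_ι, h.ι_apply]
    rfl
  have hb (i) : A (e'.symm (b.coord i)) = e.symm ((b.map A).coord i) := by
    apply e.injective
    apply A.dualMap.injective
    rw [e.apply_symm_apply]
    refine (he _).symm.trans ?_
    rw [e'.apply_symm_apply]
    ext v
    simp
  rw [h.dualLefschetz_eq (b.map A), h'.dualLefschetz_eq b, map_smul, map_sum]
  congr 1
  refine Finset.sum_congr rfl fun i _ => ?_
  rw [interiorProduct_pullback, interiorProduct_pullback]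
  simp [hb]

end SymplecticLinear

/-! ### Calculus of forms on Euclidean space -/

section EuclideanCalculus

variable {m : ℕ}

/-- Exterior forms on `ℝ^m`. -/
abbrev EuclideanAlgebra (m : ℕ) : Type :=
  ExteriorAlgebra ℝ (Dual ℝ (EuclideanSpace ℝ (Fin m)))

/-- Differentiability of the coefficients of a form. -/
def FormDifferentiableAt (a : EuclideanSpace ℝ (Fin m) → EuclideanAlgebra m)
    (y : EuclideanSpace ℝ (Fin m)) : Prop :=
  ∀ I, DifferentiableAt ℝ (fun z => (formBasis m).coord I (a z)) y

variable {a b : EuclideanSpace ℝ (Fin m) → EuclideanAlgebra m}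
  {f : EuclideanSpace ℝ (Fin m) → ℝ}
  {y : EuclideanSpace ℝ (Fin m)} {s : Set (EuclideanSpace ℝ (Fin m))}

theorem coordBasis_apply (i : Fin m) :
    coordBasis m i = (EuclideanSpace.basisFun (Fin m) ℝ).toBasis.coord i := by
  rw [coordBasis, Basis.coe_dualBasis]

theorem sum_apply_smul_coordBasis (η : Dual ℝ (EuclideanSpace ℝ (Fin m))) :
    ∑ i, η (EuclideanSpace.single i 1) • coordBasis m i = η := by
  have h := IsSymplectic.sum_apply_smul_coord (EuclideanSpace.basisFun (Fin m) ℝ).toBasis η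
  simpa only [coordBasis_apply, OrthonormalBasis.coe_toBasis, EuclideanSpace.basisFun_apply]
    using h

theorem coord_partialDeriv (i : Fin m) (J : Finset (Fin m)) :
    (formBasis m).coord J (partialDeriv i a y) =
      fderiv ℝ (fun z => (formBasis m).coord J (a z)) y (EuclideanSpace.single i 1) := by
  simp [partialDeriv, Finsupp.single_apply]

theorem coord_linear (T : EuclideanAlgebra m →ₗ[ℝ] EuclideanAlgebra m) (I : Finset (Fin m))
    (u : EuclideanAlgebra m) : (formBasis m).coord I (T u) =
      ∑ J, (formBasis m).coord J u * (formBasis m).coord I (T (formBasis m J)) := by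
  conv_lhs => rw [← (formBasis m).sum_repr u]
  simp only [map_sum, map_smul, smul_eq_mul, Basis.coord_apply]

theorem partialDeriv_congr (i : Fin m) (h : a =ᶠ[nhds y] b) :
    partialDeriv i a y = partialDeriv i b y := by
  simp only [partialDeriv]
  refine Finset.sum_congr rfl fun I _ => ?_
  rw [Filter.EventuallyEq.fderiv_eq (h.mono fun z hz => congrArg ((formBasis m).coord I) hz)]

theorem extDerivEuclidean_congr (h : a =ᶠ[nhds y] b) :
    extDerivEuclidean a y = extDerivEuclidean b y := by
  simp only [extDerivEuclidean, partialDeriv_congr _ h]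

theorem partialDeriv_smul_const (i : Fin m) (hf : DifferentiableAt ℝ f y)
    (u : EuclideanAlgebra m) : partialDeriv i (fun z => f z • u) y =
      fderiv ℝ f y (EuclideanSpace.single i 1) • u := by
  refine (formBasis m).ext_elem fun I => ?_
  rw [← Basis.coord_apply, ← Basis.coord_apply, coord_partialDeriv]
  simp only [map_smul, smul_eq_mul]
  rw [fderiv_mul_const hf]
  simp [mul_comm]

theorem FormDifferentiableAt.smul (hf : DifferentiableAt ℝ f y) (ha : FormDifferentiableAt a y) :
    FormDifferentiableAt (fun z => f z • a z) y := fun I => by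
  simpa only [map_smul, smul_eq_mul] using hf.fun_mul (ha I)

theorem formDifferentiableAt_const (u : EuclideanAlgebra m) :
    FormDifferentiableAt (fun _ => u) y := fun _ => differentiableAt_const _

theorem FormDifferentiableAt.sum {K : Type*} (t : Finset K)
    {c : K → EuclideanSpace ℝ (Fin m) → EuclideanAlgebra m}
    (h : ∀ j ∈ t, FormDifferentiableAt (c j) y) :
    FormDifferentiableAt (fun z => ∑ j ∈ t, c j z) y := fun I => by
  simp only [map_sum]
  exact DifferentiableAt.fun_sum fun j hj => h j hj I

theorem extDerivEuclidean_sum {K : Type*} (t : Finset K)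
    {c : K → EuclideanSpace ℝ (Fin m) → EuclideanAlgebra m}
    (h : ∀ j ∈ t, FormDifferentiableAt (c j) y) :
    extDerivEuclidean (fun z => ∑ j ∈ t, c j z) y = ∑ j ∈ t, extDerivEuclidean (c j) y := by
  classical
  induction t using Finset.induction_on with
  | empty => simp [extDerivEuclidean, partialDeriv]
  | insert j t hj ih =>
    simp only [Finset.sum_insert hj]
    rw [extDerivEuclidean_add (h j (by simp))
      (FormDifferentiableAt.sum t fun i hi => h i (by simp [hi])),
      ih fun i hi => h i (by simp [hi])]

/-- `d(f u) = df ∧ u` for a constant form `u`. -/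
theorem extDerivEuclidean_smul_const (hf : DifferentiableAt ℝ f y) (u : EuclideanAlgebra m) :
    extDerivEuclidean (fun z => f z • u) y =
      ExteriorAlgebra.ι ℝ (fderiv ℝ f y).toLinearMap * u := by
  rw [← sum_apply_smul_coordBasis (fderiv ℝ f y).toLinearMap]
  simp only [extDerivEuclidean, partialDeriv_smul_const _ hf, map_sum, map_smul, Finset.sum_mul,
    mul_smul_comm, smul_mul_assoc]
  rfl

theorem sum_coord_smul_const (a : EuclideanSpace ℝ (Fin m) → EuclideanAlgebra m) :
    a = fun z => ∑ I, (formBasis m).coord I (a z) • formBasis m I :=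
  funext fun z => ((formBasis m).sum_repr (a z)).symm

theorem extDerivEuclidean_eq_sum (ha : FormDifferentiableAt a y) :
    extDerivEuclidean a y = ∑ I, ExteriorAlgebra.ι ℝ
      (fderiv ℝ (fun z => (formBasis m).coord I (a z)) y).toLinearMap * formBasis m I := by
  conv_lhs => rw [sum_coord_smul_const a]
  rw [extDerivEuclidean_sum _ fun I _ => (formDifferentiableAt_const _).smul (ha I)]
  exact Finset.sum_congr rfl fun I _ => extDerivEuclidean_smul_const (ha I) _

/-- `d(f a) = df ∧ a + f da`. -/
theorem extDerivEuclidean_smul (hf : DifferentiableAt ℝ f y) (ha : FormDifferentiableAt a y) :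
    extDerivEuclidean (fun z => f z • a z) y =
      ExteriorAlgebra.ι ℝ (fderiv ℝ f y).toLinearMap * a y + f y • extDerivEuclidean a y := by
  have h1 : FormDifferentiableAt (fun z => f z • (1 : EuclideanAlgebra m)) y :=
    (formDifferentiableAt_const _).smul hf
  have h2 (i : Fin m) : partialDeriv i (fun z => f z • a z) y =
      fderiv ℝ f y (EuclideanSpace.single i 1) • a y + f y • partialDeriv i a y := by
    have := partialDeriv_mul i h1 ha
    rw [partialDeriv_smul_const i hf] at this
    simpa using this
  have h3 := extDerivEuclidean_smul_const hf (a y)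
  simp only [extDerivEuclidean, partialDeriv_smul_const _ hf] at h3
  rw [← h3]
  simp only [extDerivEuclidean, h2, mul_add, Finset.sum_add_distrib, Finset.smul_sum,
    mul_smul_comm]

/-- `d(τ a) = dτ ∧ a - τ ∧ da` for a `1`-form `τ`. -/
theorem extDerivEuclidean_one_mul (ha1 : a y ∈ ⋀[ℝ]^1 (Dual ℝ (EuclideanSpace ℝ (Fin m))))
    (ha : FormDifferentiableAt a y) (hb : FormDifferentiableAt b y) :
    extDerivEuclidean (fun z => a z * b z) y =
      extDerivEuclidean a y * b y - a y * extDerivEuclidean b y := by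
  simp only [extDerivEuclidean, Finset.sum_mul, Finset.mul_sum, ← Finset.sum_sub_distrib]
  refine Finset.sum_congr rfl fun i _ => ?_
  rw [partialDeriv_mul i ha hb, mul_add, ← mul_assoc, ← mul_assoc, ι_mul_comm_of_mem _ ha1,
    pow_one, neg_one_smul, neg_mul, ← sub_eq_add_neg, mul_assoc (a y)]

/-- Symmetric coefficients against antisymmetric products: swapping indices changes the sign. With
symmetry of second derivatives this gives `d² = 0` and closedness of pulled-back constant covectors.
-/
theorem sum_smul_ι_mul_ι_eq_zero {U : Type*} [AddCommGroup U] [Module ℝ U] {K : Type*} [Fintype K]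
    (u : K → U) (S : K → K → ℝ) (hS : ∀ i j, S i j = S j i) :
    ∑ i, ∑ j, S i j • (ExteriorAlgebra.ι ℝ (u i) * ExteriorAlgebra.ι ℝ (u j)) = 0 := by
  have h : ∑ i, ∑ j, S i j • (ExteriorAlgebra.ι ℝ (u i) * ExteriorAlgebra.ι ℝ (u j)) =
      -∑ i, ∑ j, S i j • (ExteriorAlgebra.ι ℝ (u i) * ExteriorAlgebra.ι ℝ (u j)) := by
    conv_lhs => rw [Finset.sum_comm]
    simp only [← Finset.sum_neg_distrib]
    refine Finset.sum_congr rfl fun i _ => Finset.sum_congr rfl fun j _ => ?_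
    rw [hS, eq_neg_of_add_eq_zero_left (ExteriorAlgebra.ι_add_mul_swap (R := ℝ) (u j) (u i)),
      smul_neg]
  have h2 := add_eq_zero_iff_eq_neg.2 h
  rw [← two_smul ℝ] at h2
  exact (smul_eq_zero.1 h2).resolve_left two_ne_zero

theorem SmoothFormOn.linear (T : EuclideanAlgebra m →ₗ[ℝ] EuclideanAlgebra m)
    (ha : SmoothFormOn a s) : SmoothFormOn (fun y => T (a y)) s := fun I => by
  simp only [coord_linear T I (a _)]
  exact ContDiffOn.sum fun J _ => (ha J).mul contDiffOn_const

theorem SmoothFormOn.smul (hf : ContDiffOn ℝ ∞ f s) (ha : SmoothFormOn a s) :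
    SmoothFormOn (fun y => f y • a y) s := fun I => by
  simpa only [map_smul, smul_eq_mul] using hf.mul (ha I)

theorem smoothFormOn_const (u : EuclideanAlgebra m) : SmoothFormOn (fun _ => u) s :=
  fun _ => contDiffOn_const

theorem SmoothFormOn.sum {K : Type*} (t : Finset K)
    {c : K → EuclideanSpace ℝ (Fin m) → EuclideanAlgebra m} (h : ∀ j ∈ t, SmoothFormOn (c j) s) :
    SmoothFormOn (fun y => ∑ j ∈ t, c j y) s := fun I => by
  simp only [map_sum]
  exact ContDiffOn.sum fun j hj => h j hj I

theorem SmoothFormOn.congr (ha : SmoothFormOn a s) (h : ∀ y ∈ s, b y = a y) :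
    SmoothFormOn b s := fun I => (ha I).congr fun y hy => by rw [h y hy]

theorem SmoothFormOn.contDiffOn_dual (ha : SmoothFormOn a s) (ℓ : Dual ℝ (EuclideanAlgebra m)) :
    ContDiffOn ℝ ∞ (fun y => ℓ (a y)) s := by
  have h (y) : ℓ (a y) = ∑ I, (formBasis m).coord I (a y) * ℓ (formBasis m I) := by
    conv_lhs => rw [← (formBasis m).sum_repr (a y)]
    simp only [map_sum, map_smul, smul_eq_mul, Basis.coord_apply]
  simp only [h]
  exact ContDiffOn.sum fun J _ => (ha J).mul contDiffOn_const

theorem SmoothFormOn.formDifferentiableAt (ha : SmoothFormOn a s) (hs : IsOpen s) (hy : y ∈ s) :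
    FormDifferentiableAt a y := ha.differentiableAt (hs.mem_nhds hy)

theorem ContDiffOn.fderiv_apply_const {F : Type*} [NormedAddCommGroup F] [NormedSpace ℝ F]
    {g : EuclideanSpace ℝ (Fin m) → F} (hg : ContDiffOn ℝ ∞ g s) (hs : IsOpen s)
    (v : EuclideanSpace ℝ (Fin m)) : ContDiffOn ℝ ∞ (fun z => fderiv ℝ g z v) s :=
  (hg.fderiv_of_isOpen hs (m := ∞) (by simp)).clm_apply contDiffOn_const

theorem fderiv_fderiv_comm {F : Type*} [NormedAddCommGroup F] [NormedSpace ℝ F]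
    {g : EuclideanSpace ℝ (Fin m) → F} (hg : ContDiffOn ℝ ∞ g s) (hs : IsOpen s) (hy : y ∈ s)
    (v w : EuclideanSpace ℝ (Fin m)) :
    fderiv ℝ (fun z => fderiv ℝ g z w) y v = fderiv ℝ (fun z => fderiv ℝ g z v) y w := by
  have hg' : DifferentiableAt ℝ (fderiv ℝ g) y :=
    ((hg.fderiv_of_isOpen hs (m := ∞) (by simp)).contDiffAt
      (hs.mem_nhds hy)).differentiableAt (by simp)
  have h (u : EuclideanSpace ℝ (Fin m)) :
      fderiv ℝ (fun z => fderiv ℝ g z u) y = (fderiv ℝ (fderiv ℝ g) y).flip u :=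
    (hg'.hasFDerivAt.clm_apply (hasFDerivAt_const u y)).fderiv.trans (by ext; simp)
  rw [h, h]
  exact (hg.contDiffAt (hs.mem_nhds hy)).isSymmSndFDerivAt (by
    rw [minSmoothness_of_isRCLikeNormedField]; exact ENat.LEInfty.out) v w

theorem SmoothFormOn.extDerivEuclidean (ha : SmoothFormOn a s) (hs : IsOpen s) :
    SmoothFormOn (extDerivEuclidean a) s := by
  refine SmoothFormOn.sum _ fun i _ =>
    SmoothFormOn.linear (LinearMap.mulLeft ℝ (ExteriorAlgebra.ι ℝ (coordBasis m i))) fun J => ?_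
  simp only [coord_partialDeriv]
  exact ContDiffOn.fderiv_apply_const (ha J) hs _

theorem extDerivEuclidean_extDerivEuclidean (ha : SmoothFormOn a s) (hs : IsOpen s)
    (hy : y ∈ s) : extDerivEuclidean (InvariantForms.extDerivEuclidean a) y = 0 := by
  have h1 : InvariantForms.extDerivEuclidean a =ᶠ[nhds y] fun z => ∑ I, ∑ j,
      fderiv ℝ (fun z => (formBasis m).coord I (a z)) z (EuclideanSpace.single j 1) •
        (ExteriorAlgebra.ι ℝ (coordBasis m j) * formBasis m I) := by
    filter_upwards [hs.mem_nhds hy] with z hz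
    rw [extDerivEuclidean_eq_sum (ha.formDifferentiableAt hs hz)]
    refine Finset.sum_congr rfl fun I _ => ?_
    rw [← sum_apply_smul_coordBasis (fderiv ℝ _ z).toLinearMap, map_sum, Finset.sum_mul]
    simp only [map_smul, smul_mul_assoc]
    rfl
  have h2 (I : Finset (Fin m)) (j : Fin m) : DifferentiableAt ℝ (fun z => fderiv ℝ
      (fun z => (formBasis m).coord I (a z)) z (EuclideanSpace.single j 1)) y :=
    ((ContDiffOn.fderiv_apply_const (ha I) hs _).contDiffAt
      (hs.mem_nhds hy)).differentiableAt (by simp)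
  rw [extDerivEuclidean_congr h1, extDerivEuclidean_sum _ fun I _ =>
    FormDifferentiableAt.sum _ fun j _ => (formDifferentiableAt_const _).smul (h2 I j)]
  refine Finset.sum_eq_zero fun I _ => ?_
  rw [extDerivEuclidean_sum _ fun j _ => (formDifferentiableAt_const _).smul (h2 I j)]
  have h3 := congrArg (· * formBasis m I) (sum_smul_ι_mul_ι_eq_zero (coordBasis m)
    (fun j i => fderiv ℝ (fun z => fderiv ℝ (fun z => (formBasis m).coord I (a z)) z
      (EuclideanSpace.single j 1)) y (EuclideanSpace.single i 1))
    fun i j => fderiv_fderiv_comm (ha I) hs hy _ _)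
  simp only [zero_mul, Finset.sum_mul] at h3
  -- The second derivative puts its `dx^i` in front of `dx^j`, in the order opposite to `h3`; hence
  -- the sign.
  rw [← neg_eq_zero, ← h3, ← Finset.sum_neg_distrib]
  refine Finset.sum_congr rfl fun j _ => ?_
  rw [extDerivEuclidean_smul_const (h2 I j), ← sum_apply_smul_coordBasis (fderiv ℝ _ y).toLinearMap,
    map_sum, Finset.sum_mul, ← Finset.sum_neg_distrib]
  refine Finset.sum_congr rfl fun i _ => ?_
  rw [map_smul, smul_mul_assoc, smul_mul_assoc, ← mul_assoc, ← smul_neg, ← neg_mul,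
    ← eq_neg_of_add_eq_zero_left (ExteriorAlgebra.ι_add_mul_swap (R := ℝ) _ _)]
  rfl

/-! ### Pullback along smooth maps -/

variable {ψ : EuclideanSpace ℝ (Fin m) → EuclideanSpace ℝ (Fin m)}

theorem ι_mem_exteriorPower_one {U : Type*} [AddCommGroup U] [Module ℝ U] (u : U) :
    ExteriorAlgebra.ι ℝ u ∈ ⋀[ℝ]^1 U := by
  have h := LinearMap.mem_range_self (ExteriorAlgebra.ι ℝ : U →ₗ[ℝ] _) u
  rwa [← pow_one (LinearMap.range _)] at h

/-- Pullbacks of constant forms are smooth and closed. -/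
theorem pullback_const (hψ : ContDiffOn ℝ ∞ ψ s) (hs : IsOpen s) (u : EuclideanAlgebra m) :
    SmoothFormOn (fun z => pullback (fderiv ℝ ψ z).toLinearMap u) s ∧
      ∀ y ∈ s, extDerivEuclidean (fun z => pullback (fderiv ℝ ψ z).toLinearMap u) y = 0 := by
  induction u using CliffordAlgebra.left_induction with
  | algebraMap r =>
    have h (z) : pullback (fderiv ℝ ψ z).toLinearMap (algebraMap ℝ (EuclideanAlgebra m) r) =
      algebraMap ℝ _ r := AlgHom.commutes _ r
    erw [funext h]
    refine ⟨smoothFormOn_const _, fun y _ => ?_⟩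
    simp [extDerivEuclidean, partialDeriv]
  | add u v hu hv =>
    simp only [map_add]
    refine ⟨hu.1.add hv.1, fun y hy => ?_⟩
    rw [extDerivEuclidean_add (hu.1.formDifferentiableAt hs hy)
      (hv.1.formDifferentiableAt hs hy), hu.2 y hy, hv.2 y hy, add_zero]
  | ι_mul u θ hu =>
    -- These are the coefficients of `ψ^* θ = d(θ ∘ ψ)`.
    set f : Fin m → EuclideanSpace ℝ (Fin m) → ℝ := fun j z =>
      θ (fderiv ℝ ψ z (EuclideanSpace.single j 1)) with hf
    have hθ : ContDiffOn ℝ ∞ (fun z => θ (ψ z)) s :=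
      (LinearMap.toContinuousLinearMap θ).contDiff.comp_contDiffOn hψ
    have hfd (j : Fin m) {z} (hz : z ∈ s) : f j z =
        fderiv ℝ (fun z => θ (ψ z)) z (EuclideanSpace.single j 1) := by
      have h1 : DifferentiableAt ℝ ψ z := (hψ.contDiffAt (hs.mem_nhds hz)).differentiableAt (by simp)
      have h2 := ((LinearMap.toContinuousLinearMap θ).hasFDerivAt.comp z h1.hasFDerivAt).fderiv
      exact (congrArg (fun A : EuclideanSpace ℝ (Fin m) →L[ℝ] ℝ =>
        A (EuclideanSpace.single j 1)) h2).symm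
    have hfs (j : Fin m) : ContDiffOn ℝ ∞ (f j) s :=
      (ContDiffOn.fderiv_apply_const hθ hs _).congr fun z hz => hfd j hz
    have hfy (j : Fin m) {y} (hy : y ∈ s) : DifferentiableAt ℝ (f j) y :=
      ((hfs j).contDiffAt (hs.mem_nhds hy)).differentiableAt (by simp)
    have hτ (z) : pullback (fderiv ℝ ψ z).toLinearMap (ExteriorAlgebra.ι ℝ θ) =
        ∑ j, f j z • ExteriorAlgebra.ι ℝ (coordBasis m j) := by
      rw [pullback, ExteriorAlgebra.map_apply_ι, ← sum_apply_smul_coordBasis (LinearMap.dualMap _ θ),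
        map_sum]
      simp only [map_smul]
      rfl
    have hmul (z) : pullback (fderiv ℝ ψ z).toLinearMap (CliffordAlgebra.ι _ θ * u) =
        (∑ j, f j z • ExteriorAlgebra.ι ℝ (coordBasis m j)) *
          pullback (fderiv ℝ ψ z).toLinearMap u := by
      rw [map_mul, ← hτ]
    have hsm : SmoothFormOn (fun z => ∑ j, f j z • ExteriorAlgebra.ι ℝ (coordBasis m j)) s :=
      SmoothFormOn.sum _ fun j _ => (smoothFormOn_const _).smul (hfs j)
    rw [funext hmul]
    refine ⟨hsm.mul hu.1, fun y hy => ?_⟩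
    have hd : extDerivEuclidean (fun z => ∑ j, f j z • ExteriorAlgebra.ι ℝ (coordBasis m j)) y =
        0 := by
      rw [extDerivEuclidean_sum _ fun j _ => (formDifferentiableAt_const _).smul (hfy j hy)]
      simp only [extDerivEuclidean_smul_const (hfy _ hy)]
      have h1 (j : Fin m) : fderiv ℝ (f j) y = fderiv ℝ (fun z => fderiv ℝ (fun z => θ (ψ z)) z
          (EuclideanSpace.single j 1)) y :=
        Filter.EventuallyEq.fderiv_eq (by
          filter_upwards [hs.mem_nhds hy] with z hz using hfd j hz)
      have h2 := sum_smul_ι_mul_ι_eq_zero (coordBasis m)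
        (fun i j => fderiv ℝ (f j) y (EuclideanSpace.single i 1)) fun i j => by
          rw [h1, h1, fderiv_fderiv_comm hθ hs hy]
      rw [← h2, Finset.sum_comm]
      refine Finset.sum_congr rfl fun j _ => ?_
      rw [← sum_apply_smul_coordBasis (fderiv ℝ _ y).toLinearMap, map_sum, Finset.sum_mul]
      simp only [map_smul, smul_mul_assoc]
      rfl
    rw [extDerivEuclidean_one_mul ?_ (hsm.formDifferentiableAt hs hy)
      (hu.1.formDifferentiableAt hs hy), hd, hu.2 y hy, zero_mul, mul_zero, sub_zero]
    rw [← hτ]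
    exact pullback_mem _ (ι_mem_exteriorPower_one θ)

/-- The exterior derivative commutes with pullbacks. -/
theorem extDerivEuclidean_pullback (hψ : ContDiffOn ℝ ∞ ψ s) (hs : IsOpen s) (hy : y ∈ s)
    (ha : FormDifferentiableAt a (ψ y)) :
    extDerivEuclidean (fun z => pullback (fderiv ℝ ψ z).toLinearMap (a (ψ z))) y =
      pullback (fderiv ℝ ψ y).toLinearMap (extDerivEuclidean a (ψ y)) := by
  have hψy : DifferentiableAt ℝ ψ y := (hψ.contDiffAt (hs.mem_nhds hy)).differentiableAt (by simp)
  -- The pullbacks of the basis forms are closed by `pullback_const`, so only the coefficients are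
  -- differentiated, by the chain rule.
  have h1 (z) : pullback (fderiv ℝ ψ z).toLinearMap (a (ψ z)) = ∑ I,
      (formBasis m).coord I (a (ψ z)) • pullback (fderiv ℝ ψ z).toLinearMap (formBasis m I) := by
    conv_lhs => rw [← (formBasis m).sum_repr (a (ψ z))]
    simp only [map_sum, map_smul, Basis.coord_apply]
  have h2 (I : Finset (Fin m)) : DifferentiableAt ℝ (fun z => (formBasis m).coord I (a (ψ z))) y :=
    (ha I).comp y hψy
  have h3 (I : Finset (Fin m)) := (pullback_const hψ hs (formBasis m I)).1.formDifferentiableAt hs hy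
  rw [funext h1, extDerivEuclidean_sum _ fun I _ => (h3 I).smul (h2 I),
    extDerivEuclidean_eq_sum ha, map_sum]
  refine Finset.sum_congr rfl fun I _ => ?_
  have h4 : (fderiv ℝ (fun z => (formBasis m).coord I (a (ψ z))) y).toLinearMap =
      (fderiv ℝ ψ y).toLinearMap.dualMap
        (fderiv ℝ (fun z => (formBasis m).coord I (a z)) (ψ y)).toLinearMap :=
    congrArg ContinuousLinearMap.toLinearMap (fderiv_comp y (ha I) hψy)
  rw [extDerivEuclidean_smul (h2 I) (h3 I), (pullback_const hψ hs _).2 y hy, smul_zero, add_zero,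
    map_mul, h4, ← ExteriorAlgebra.map_apply_ι]
  rfl

/-! ### Smooth dependence of the dual Lefschetz operator -/

theorem contDiffOn_det {F : Type*} [NormedAddCommGroup F] [NormedSpace ℝ F] {t : Set F}
    {K : Type*} [Fintype K] [DecidableEq K] {G : F → Matrix K K ℝ}
    (hG : ∀ i j, ContDiffOn ℝ ∞ (fun z => G z i j) t) : ContDiffOn ℝ ∞ (fun z => (G z).det) t := by
  simp only [Matrix.det_apply]
  exact ContDiffOn.sum fun p _ => (contDiffOn_prod fun i _ => hG _ _).const_smul _

/-- Cramer's rule. -/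
theorem contDiffOn_inv_apply {F : Type*} [NormedAddCommGroup F] [NormedSpace ℝ F] {t : Set F}
    {K : Type*} [Fintype K] [DecidableEq K] {G : F → Matrix K K ℝ}
    (hG : ∀ i j, ContDiffOn ℝ ∞ (fun z => G z i j) t) (h0 : ∀ z ∈ t, (G z).det ≠ 0) (i j : K) :
    ContDiffOn ℝ ∞ (fun z => (G z)⁻¹ i j) t := by
  simp only [Matrix.inv_def, Ring.inverse_eq_inv', Matrix.smul_apply, Matrix.adjugate_apply,
    smul_eq_mul]
  refine ((contDiffOn_det hG).inv h0).mul (contDiffOn_det fun k l => ?_)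
  by_cases hk : k = j
  · simp only [hk, Matrix.updateRow_self]
    exact contDiffOn_const
  · simp only [Matrix.updateRow_ne hk]
    exact hG k l

/-- The contraction of a smooth form by the bivector of a smooth symplectic form is smooth. -/
theorem SmoothFormOn.dualLefschetz {e : EuclideanSpace ℝ (Fin m) →
      EuclideanSpace ℝ (Fin m) ≃ₗ[ℝ] Dual ℝ (EuclideanSpace ℝ (Fin m))}
    (ha : SmoothFormOn a s) (hb : SmoothFormOn b s) (he : ∀ y ∈ s, IsSymplectic (a y) (e y)) :
    SmoothFormOn (fun y => dualLefschetz (a y) (e y) (b y)) s := by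
  set β := (EuclideanSpace.basisFun (Fin m) ℝ).toBasis
  set G : EuclideanSpace ℝ (Fin m) → Matrix (Fin m) (Fin m) ℝ := fun y =>
    LinearMap.toMatrix β β.dualBasis (e y).toLinearMap with hG
  have hmul (y) : G y * LinearMap.toMatrix β.dualBasis β (e y).symm.toLinearMap = 1 := by
    rw [hG, ← LinearMap.toMatrix_comp, LinearEquiv.comp_coe, LinearEquiv.symm_trans_self,
      LinearEquiv.refl_toLinearMap, LinearMap.toMatrix_id]
  have hinv (y) : (G y)⁻¹ = LinearMap.toMatrix β.dualBasis β (e y).symm.toLinearMap := by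
    exact Matrix.inv_eq_right_inv (hmul y)
  have hdet (y) : (G y).det ≠ 0 :=
    left_ne_zero_of_mul_eq_one (by rw [← Matrix.det_mul, hmul y, Matrix.det_one])
  -- The entry `(e β_j)(β_i)` is `i_{β_i} i_{β_j} a`, a fixed linear functional of `a`.
  have hGs (i j) : ContDiffOn ℝ ∞ (fun y => G y i j) s := by
    refine (ha.contDiffOn_dual (ExteriorAlgebra.algebraMapInv.toLinearMap ∘ₗ
      interiorProduct (β i) ∘ₗ interiorProduct (β j))).congr fun y hy => ?_
    have h : algebraMap ℝ (EuclideanAlgebra m) (e y (β j) (β i)) =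
        interiorProduct (β i) (interiorProduct (β j) (a y)) := by
      rw [← (he y hy).ι_apply, interiorProduct_ι]
    have h2 := ExteriorAlgebra.algebraMap_leftInverse (R := ℝ)
      (Dual ℝ (EuclideanSpace ℝ (Fin m))) (e y (β j) (β i))
    rw [h] at h2
    refine Eq.trans ?_ h2.symm
    simp [hG, LinearMap.toMatrix_apply]
  have hsymm (y) (i : Fin m) : (e y).symm (β.coord i) = ∑ j, (G y)⁻¹ j i • β j := by
    rw [← β.sum_repr ((e y).symm (β.coord i)), hinv]
    simp [LinearMap.toMatrix_apply]
  have key (y) (hy : y ∈ s) : InvariantForms.dualLefschetz (a y) (e y) (b y) =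
      (2 : ℝ)⁻¹ • ∑ i, ∑ j, (G y)⁻¹ j i • (interiorProduct (β i) ∘ₗ interiorProduct (β j)) (b y) := by
    rw [(he y hy).dualLefschetz_eq β]
    simp only [hsymm, map_sum, map_smul, LinearMap.sum_apply, LinearMap.smul_apply,
      LinearMap.comp_apply]
  refine SmoothFormOn.congr (SmoothFormOn.const_smul _ (SmoothFormOn.sum _ fun i _ =>
    SmoothFormOn.sum _ fun j _ => ?_)) key
  exact (hb.linear _).smul (contDiffOn_inv_apply hGs (fun y _ => hdet y) j i)

end EuclideanCalculus

/-! ### Change of charts -/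

section ChangeOfCharts

variable {m : ℕ} {M : Type*} [TopologicalSpace M] [ChartedSpace (EuclideanSpace ℝ (Fin m)) M]

/-- The differential at `q` of the chart at `x₁`. -/
def chartDerivAt (x₁ q : M) : TangentSpace (𝓡 m) q →ₗ[ℝ] EuclideanSpace ℝ (Fin m) :=
  ContinuousLinearMap.toLinearMap (M₂ := EuclideanSpace ℝ (Fin m))
    (mfderiv (𝓡 m) (𝓡 m) (extChartAt (𝓡 m) x₁) q)

/-- The expression of the map `γ` in the charts at `x₀` and `x₁`. -/
def chartExpr (x₀ x₁ : M) (γ : M → M) (y : EuclideanSpace ℝ (Fin m)) :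
    EuclideanSpace ℝ (Fin m) :=
  extChartAt (𝓡 m) x₁ (γ ((extChartAt (𝓡 m) x₀).symm y))

/-- The domain on which `chartExpr x₀ x₁ γ` is smooth if `γ` is smooth on `s`. -/
def chartExprDomain (x₀ x₁ : M) (γ : M → M) (s : Set M) : Set (EuclideanSpace ℝ (Fin m)) :=
  (extChartAt (𝓡 m) x₀).target ∩
    (extChartAt (𝓡 m) x₀).symm ⁻¹' (s ∩ γ ⁻¹' (extChartAt (𝓡 m) x₁).source)

theorem extDerivForm_mem {ξ : Form m M} (hξs : IsSmooth ξ) {k : ℕ}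
    (hξ : ∀ x, ξ x ∈ ⋀[ℝ]^k (Dual ℝ (TangentSpace (𝓡 m) x))) (x : M) :
    extDerivForm ξ x ∈ ⋀[ℝ]^(k + 1) (Dual ℝ (TangentSpace (𝓡 m) x)) := by
  refine pullback_mem _ (sum_mem fun i _ => ?_)
  have h : partialDeriv i (inChart x ξ) (extChartAt (𝓡 m) x x) ∈
      ⋀[ℝ]^k (Dual ℝ (EuclideanSpace ℝ (Fin m))) := by
    -- A linear functional that vanishes on `k`-forms commutes with `∂_i`, so it also vanishes on
    -- the derivative of a family of `k`-forms.
    rw [← Subspace.forall_mem_dualAnnihilator_apply_eq_zero_iff]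
    intro φ hφ
    have h1 : φ (partialDeriv i (inChart x ξ) (extChartAt (𝓡 m) x x)) =
        fderiv ℝ (fun z => φ (inChart x ξ z)) (extChartAt (𝓡 m) x x)
          (EuclideanSpace.single i 1) := by
      have h2 (z) : φ (inChart x ξ z) =
          ∑ I, (formBasis m).coord I (inChart x ξ z) * φ (formBasis m I) := by
        conv_lhs => rw [← (formBasis m).sum_repr (inChart x ξ z)]
        simp only [map_sum, map_smul, smul_eq_mul, Basis.coord_apply]
      simp only [h2]
      rw [fderiv_fun_sum fun I _ => (hξs.differentiableAt x I).mul_const _]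
      rw [partialDeriv, map_sum, sum_apply]
      refine Finset.sum_congr rfl fun I _ => ?_
      rw [fderiv_mul_const (hξs.differentiableAt x I), map_smul, smul_apply, smul_eq_mul,
        smul_eq_mul, mul_comm]
    rw [h1]
    have h2 : (fun z => φ (inChart x ξ z)) = fun _ => 0 := funext fun z =>
      (Submodule.mem_dualAnnihilator φ).1 hφ _ (inChart_mem x hξ z)
    simp [h2]
  have h' := ι_mul_mem_extGrade (coordBasis m i) (by rw [extGrade_natCast]; exact h)
  rwa [← Nat.cast_succ, extGrade_natCast] at h'

variable {x₀ x₁ : M} {γ : M → M} {s : Set M}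

theorem isOpen_chartExprDomain (hγ : ContMDiffOn (𝓡 m) (𝓡 m) ∞ γ s) (hs : IsOpen s) :
    IsOpen (chartExprDomain (m := m) x₀ x₁ γ s) :=
  (continuousOn_extChartAt_symm x₀).isOpen_inter_preimage (isOpen_extChartAt_target x₀)
    (hγ.continuousOn.isOpen_inter_preimage hs (isOpen_extChartAt_source x₁))

variable [IsManifold (𝓡 m) ∞ M]

theorem mdifferentiableAt_extChartAt_symm {y : EuclideanSpace ℝ (Fin m)}
    (hy : y ∈ (extChartAt (𝓡 m) x₀).target) :
    MDifferentiableAt (𝓡 m) (𝓡 m) (extChartAt (𝓡 m) x₀).symm y :=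
  ((contMDiffOn_extChartAt_symm (n := ∞) x₀).contMDiffAt
    ((isOpen_extChartAt_target x₀).mem_nhds hy)).mdifferentiableAt (by simp)

theorem mdifferentiableAt_extChartAt_of_mem {q : M} (hq : q ∈ (extChartAt (𝓡 m) x₁).source) :
    MDifferentiableAt (𝓡 m) (𝓡 m) (extChartAt (𝓡 m) x₁) q :=
  (contMDiffAt_extChartAt' (n := ∞) (by rwa [extChartAt_source] at hq)).mdifferentiableAt (by simp)

theorem contDiffOn_chartExpr (hγ : ContMDiffOn (𝓡 m) (𝓡 m) ∞ γ s) :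
    ContDiffOn ℝ ∞ (chartExpr (m := m) x₀ x₁ γ) (chartExprDomain x₀ x₁ γ s) := by
  rw [← contMDiffOn_iff_contDiffOn]
  have h1 : ContMDiffOn (𝓡 m) (𝓡 m) ∞ (extChartAt (𝓡 m) x₁) (extChartAt (𝓡 m) x₁).source := by
    rw [extChartAt_source]
    exact contMDiffOn_extChartAt
  exact h1.comp (hγ.comp ((contMDiffOn_extChartAt_symm x₀).mono fun _ h => h.1)
    fun _ h => h.2.1) fun _ h => h.2.2

theorem pullback_chartDerivAt_inChart (ξ : Form m M) {q : M}
    (hq : q ∈ (extChartAt (𝓡 m) x₁).source) :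
    pullback (chartDerivAt x₁ q) (inChart x₁ ξ (extChartAt (𝓡 m) x₁ q)) = ξ q := by
  have : IsManifold (𝓡 m) 1 M := IsManifold.of_le (n := ∞) (by simp)
  have h := mfderivWithin_extChartAt_symm_comp_mfderiv_extChartAt' (I := 𝓡 m) (x := x₁) hq
  rw [ModelWithCorners.range_eq_univ, mfderivWithin_univ] at h
  have h1 : (chartSymmDeriv x₁ (extChartAt (𝓡 m) x₁ q) :
      EuclideanSpace ℝ (Fin m) →ₗ[ℝ] EuclideanSpace ℝ (Fin m)) ∘ₗ
      (chartDerivAt x₁ q : EuclideanSpace ℝ (Fin m) →ₗ[ℝ] EuclideanSpace ℝ (Fin m)) =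
      LinearMap.id := congrArg ContinuousLinearMap.toLinearMap h
  -- All tangent spaces unfold to `ℝ^m`; with constant fibres the base point can be rewritten.
  let ξ' : M → EuclideanAlgebra m := ξ
  have h3 (u : EuclideanAlgebra m) :
      pullback (LinearMap.id : EuclideanSpace ℝ (Fin m) →ₗ[ℝ] _) u = u := by
    simp [pullback]
  refine (pullback_comp (V := EuclideanSpace ℝ (Fin m)) (W := EuclideanSpace ℝ (Fin m))
    (U := EuclideanSpace ℝ (Fin m)) (chartSymmDeriv x₁ (extChartAt (𝓡 m) x₁ q))
    (chartDerivAt x₁ q) (ξ' ((extChartAt (𝓡 m) x₁).symm (extChartAt (𝓡 m) x₁ q)))).symm.trans ?_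
  refine (congrArg (fun A : EuclideanSpace ℝ (Fin m) →ₗ[ℝ] EuclideanSpace ℝ (Fin m) =>
    pullback A (ξ' ((extChartAt (𝓡 m) x₁).symm (extChartAt (𝓡 m) x₁ q)))) h1).trans ?_
  exact (h3 _).trans (congrArg ξ' ((extChartAt (𝓡 m) x₁).left_inv hq))

theorem chartSymmDeriv_injective {y : EuclideanSpace ℝ (Fin m)}
    (hy : y ∈ (extChartAt (𝓡 m) x₀).target) : Function.Injective (chartSymmDeriv x₀ y) := by
  have : IsManifold (𝓡 m) 1 M := IsManifold.of_le (n := ∞) (by simp)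
  have h := mfderiv_extChartAt_comp_mfderivWithin_extChartAt_symm (I := 𝓡 m) (x := x₀) hy
  rw [ModelWithCorners.range_eq_univ, mfderivWithin_univ] at h
  exact Function.LeftInverse.injective (g := chartDerivAt x₀ ((extChartAt (𝓡 m) x₀).symm y))
    fun v => DFunLike.congr_fun h v

theorem fderiv_chartExpr (hγ : ContMDiffOn (𝓡 m) (𝓡 m) ∞ γ s) (hs : IsOpen s)
    {y : EuclideanSpace ℝ (Fin m)} (hy : y ∈ chartExprDomain x₀ x₁ γ s) :
    (fderiv ℝ (chartExpr x₀ x₁ γ) y).toLinearMap =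
      chartDerivAt x₁ (γ ((extChartAt (𝓡 m) x₀).symm y)) ∘ₗ
        (mfderiv (𝓡 m) (𝓡 m) γ ((extChartAt (𝓡 m) x₀).symm y)).toLinearMap ∘ₗ
          chartSymmDeriv x₀ y := by
  have h1 := mdifferentiableAt_extChartAt_symm hy.1
  have h2 : MDifferentiableAt (𝓡 m) (𝓡 m) γ ((extChartAt (𝓡 m) x₀).symm y) :=
    (hγ.contMDiffAt (hs.mem_nhds hy.2.1)).mdifferentiableAt (by simp)
  have h3 := mdifferentiableAt_extChartAt_of_mem (x₁ := x₁) hy.2.2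
  have h4 := mfderiv_comp y h3 (h2.comp y h1)
  rw [mfderiv_comp y h2 h1, mfderiv_eq_fderiv] at h4
  exact congrArg ContinuousLinearMap.toLinearMap h4

/-- If `ξ = γ^* ξ` on `s`, then the expressions of `ξ` in two charts are related by the pullback
along the expression of `γ`. -/
theorem inChart_eq_pullback (hγ : ContMDiffOn (𝓡 m) (𝓡 m) ∞ γ s) (hs : IsOpen s) {ξ : Form m M}
    (hξ : ∀ x ∈ s, ξ x = pullback (mfderiv (𝓡 m) (𝓡 m) γ x).toLinearMap (ξ (γ x)))
    {y : EuclideanSpace ℝ (Fin m)} (hy : y ∈ chartExprDomain x₀ x₁ γ s) :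
    inChart x₀ ξ y = pullback (fderiv ℝ (chartExpr x₀ x₁ γ) y).toLinearMap
      (inChart x₁ ξ (chartExpr x₀ x₁ γ y)) := by
  rw [fderiv_chartExpr hγ hs hy, pullback_comp, pullback_comp, inChart, hξ _ hy.2.1]
  congr 2
  exact (pullback_chartDerivAt_inChart ξ hy.2.2).symm

theorem extDerivEuclidean_inChart (hγ : ContMDiffOn (𝓡 m) (𝓡 m) ∞ γ s) (hs : IsOpen s)
    {ξ : Form m M} (hξs : IsSmooth ξ)
    (hξ : ∀ x ∈ s, ξ x = pullback (mfderiv (𝓡 m) (𝓡 m) γ x).toLinearMap (ξ (γ x)))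
    {y : EuclideanSpace ℝ (Fin m)} (hy : y ∈ chartExprDomain x₀ x₁ γ s) :
    extDerivEuclidean (inChart x₀ ξ) y =
      pullback (fderiv ℝ (chartExpr x₀ x₁ γ) y).toLinearMap
        (extDerivEuclidean (inChart x₁ ξ) (chartExpr x₀ x₁ γ y)) := by
  have ho : IsOpen (chartExprDomain (m := m) x₀ x₁ γ s) := isOpen_chartExprDomain hγ hs
  have h : inChart x₀ ξ =ᶠ[nhds y] fun z => pullback (fderiv ℝ (chartExpr x₀ x₁ γ) z).toLinearMap
      (inChart x₁ ξ (chartExpr x₀ x₁ γ z)) := by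
    filter_upwards [ho.mem_nhds hy] with z hz using inChart_eq_pullback hγ hs hξ hz
  rw [extDerivEuclidean_congr h]
  exact extDerivEuclidean_pullback (contDiffOn_chartExpr hγ) ho hy
    ((hξs x₁).formDifferentiableAt (isOpen_extChartAt_target x₁)
      ((extChartAt (𝓡 m) x₁).map_source hy.2.2))

/-- The exterior derivative can be computed in any chart. -/
theorem inChart_extDerivForm {ξ : Form m M} (hξ : IsSmooth ξ) {y : EuclideanSpace ℝ (Fin m)}
    (hy : y ∈ (extChartAt (𝓡 m) x₀).target) :
    inChart x₀ (extDerivForm ξ) y = extDerivEuclidean (inChart x₀ ξ) y := by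
  have hid : ContMDiffOn (𝓡 m) (𝓡 m) ∞ (id : M → M) Set.univ := contMDiffOn_id
  have hξid : ∀ x ∈ Set.univ, ξ x = pullback
      (mfderiv (𝓡 m) (𝓡 m) (id : M → M) x).toLinearMap (ξ (id x)) := fun x _ => by
    rw [mfderiv_id]
    simp [pullback]
  -- The definition of `extDerivForm` at a point uses the chart at that point; taking `γ = id`
  -- compares it with the chart at `x₀`.
  have hy' : y ∈ chartExprDomain x₀ ((extChartAt (𝓡 m) x₀).symm y) id Set.univ :=
    ⟨hy, trivial, mem_extChartAt_source _⟩
  rw [extDerivEuclidean_inChart hid isOpen_univ hξ hξid hy',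
    fderiv_chartExpr hid isOpen_univ hy', mfderiv_id, pullback_comp]
  rfl

theorem IsSmooth.extDerivForm {ξ : Form m M} (hξ : IsSmooth ξ) :
    IsSmooth (extDerivForm ξ) := fun x₀ =>
  ((hξ x₀).extDerivEuclidean (isOpen_extChartAt_target x₀)).congr fun _ hy =>
    inChart_extDerivForm hξ hy

theorem extDerivForm_extDerivForm {ξ : Form m M} (hξ : IsSmooth ξ) :
    extDerivForm (extDerivForm ξ) = 0 := by
  funext x
  have hx : extChartAt (𝓡 m) x x ∈ (extChartAt (𝓡 m) x).target := mem_extChartAt_target x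
  have h : inChart x (InvariantForms.extDerivForm ξ) =ᶠ[nhds (extChartAt (𝓡 m) x x)]
      extDerivEuclidean (inChart x ξ) := by
    filter_upwards [(isOpen_extChartAt_target x).mem_nhds hx] with z hz
    exact inChart_extDerivForm hξ hz
  rw [InvariantForms.extDerivForm, extDerivEuclidean_congr h,
    extDerivEuclidean_extDerivEuclidean (hξ x) (isOpen_extChartAt_target x) hx, map_zero]
  rfl

/-- The exterior derivative of an invariant form is invariant. -/
theorem extDerivForm_eq_pullback (hγ : ContMDiffOn (𝓡 m) (𝓡 m) ∞ γ s) (hs : IsOpen s)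
    {ξ : Form m M} (hξs : IsSmooth ξ)
    (hξ : ∀ x ∈ s, ξ x = pullback (mfderiv (𝓡 m) (𝓡 m) γ x).toLinearMap (ξ (γ x)))
    {x : M} (hx : x ∈ s) : extDerivForm ξ x =
      pullback (mfderiv (𝓡 m) (𝓡 m) γ x).toLinearMap (extDerivForm ξ (γ x)) := by
  have hleft := extChartAt_to_inv (I := 𝓡 m) x
  have hy : extChartAt (𝓡 m) x x ∈ chartExprDomain x (γ x) γ s := by
    refine ⟨mem_extChartAt_target x, ?_⟩
    rw [Set.mem_preimage, hleft]
    exact ⟨hx, mem_extChartAt_source _⟩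
  have ho : IsOpen (chartExprDomain (m := m) x (γ x) γ s) := isOpen_chartExprDomain hγ hs
  have h1 : MDifferentiableAt (𝓡 m) (𝓡 m) γ x :=
    (hγ.contMDiffAt (hs.mem_nhds hx)).mdifferentiableAt (by simp)
  have h2 : MDifferentiableAt (𝓡 m) (𝓡 m) (extChartAt (𝓡 m) x) x :=
    mdifferentiableAt_extChartAt_of_mem (mem_extChartAt_source x)
  have h3 : MDifferentiableAt (𝓡 m) (𝓡 m) (extChartAt (𝓡 m) (γ x)) (γ x) :=
    mdifferentiableAt_extChartAt_of_mem (mem_extChartAt_source (γ x))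
  have h4 : MDifferentiableAt (𝓡 m) (𝓡 m) (chartExpr x (γ x) γ) (extChartAt (𝓡 m) x x) :=
    (((contDiffOn_chartExpr hγ).contDiffAt (ho.mem_nhds hy)).differentiableAt
      (by simp)).mdifferentiableAt
  have h5 : chartExpr x (γ x) γ ∘ extChartAt (𝓡 m) x =ᶠ[nhds x] extChartAt (𝓡 m) (γ x) ∘ γ := by
    filter_upwards [extChartAt_source_mem_nhds (I := 𝓡 m) x] with z hz
    rw [Function.comp_apply, Function.comp_apply, chartExpr, (extChartAt (𝓡 m) x).left_inv hz]
  have h6 := h5.mfderiv_eq (I := 𝓡 m) (I' := 𝓡 m)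
  rw [mfderiv_comp x h4 h2, mfderiv_comp x h3 h1, mfderiv_eq_fderiv] at h6
  have h7 : (fderiv ℝ (chartExpr x (γ x) γ) (extChartAt (𝓡 m) x x)).toLinearMap ∘ₗ chartDeriv x =
      chartDeriv (γ x) ∘ₗ (mfderiv (𝓡 m) (𝓡 m) γ x).toLinearMap :=
    congrArg ContinuousLinearMap.toLinearMap h6
  have h8 : chartExpr x (γ x) γ (extChartAt (𝓡 m) x x) = extChartAt (𝓡 m) (γ x) (γ x) := by
    rw [chartExpr, hleft]
  rw [InvariantForms.extDerivForm, extDerivEuclidean_inChart hγ hs hξs hξ hy, ← pullback_comp, h7,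
    pullback_comp, h8]
  rfl

theorem extDerivForm_mem_invariantForms {Γ : StructureGroupoid M}
    (hΓ : ∀ γ ∈ Γ, ContMDiffOn (𝓡 m) (𝓡 m) ∞ γ γ.source) {k : ℕ} {ξ : Form m M}
    (hξ : ξ ∈ invariantForms Γ k) : extDerivForm ξ ∈ invariantForms Γ (k + 1) :=
  ⟨extDerivForm_mem hξ.2.1 hξ.1, hξ.2.1.extDerivForm, fun γ hγ _ hx =>
    extDerivForm_eq_pullback (hΓ γ hγ) γ.open_source hξ.2.1 (hξ.2.2 γ hγ) hx⟩

end ChangeOfCharts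

/-! ### The dual Lefschetz operator on invariant forms -/

theorem IsSymplectic.pullback {V W : Type*} [AddCommGroup V] [Module ℝ V] [AddCommGroup W]
    [Module ℝ W] (A : V ≃ₗ[ℝ] W) {a : ExteriorAlgebra ℝ (Dual ℝ W)} {e : W ≃ₗ[ℝ] Dual ℝ W}
    (h : IsSymplectic a e) :
    IsSymplectic (InvariantForms.pullback A.toLinearMap a) (A ≪≫ₗ e ≪≫ₗ A.dualMap) where
  mem := pullback_mem _ h.mem
  ι_apply v := by
    rw [interiorProduct_pullback, LinearEquiv.coe_coe, ← h.ι_apply, InvariantForms.pullback,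
      ExteriorAlgebra.map_apply_ι]
    rfl

namespace SymplecticForm

variable {n : ℕ} {M : Type*} [TopologicalSpace M]
  [ChartedSpace (EuclideanSpace ℝ (Fin (2 * n))) M] {Γ : StructureGroupoid M}
  (σ : SymplecticForm n Γ)

theorem isSymplectic (x : M) : IsSymplectic (σ.form x) (σ.flatEquiv x) where
  mem := σ.mem_closedForms.1.1 x
  ι_apply v := ι_flat v (σ.mem_closedForms.1.1 x)

instance finiteDimensional_tangentSpace (x : M) :
    FiniteDimensional ℝ (TangentSpace (𝓡 (2 * n)) x) :=
  inferInstanceAs (FiniteDimensional ℝ (EuclideanSpace ℝ (Fin (2 * n))))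

theorem finrank_tangentSpace (x : M) : finrank ℝ (TangentSpace (𝓡 (2 * n)) x) = 2 * n :=
  finrank_euclideanSpace_fin

/-- The operator `L ξ = σ ∧ ξ` on forms. -/
def wedgeForm : End ℝ (Form (2 * n) M) := LinearMap.mulLeft ℝ σ.form

/-- The operator `Λ`, contraction by the bivector field corresponding to `σ`. -/
def contractForm : End ℝ (Form (2 * n) M) where
  toFun ξ x := dualLefschetz (σ.form x) (σ.flatEquiv x) (ξ x)
  map_add' ξ η := funext fun x => map_add _ (ξ x) (η x)
  map_smul' c ξ := funext fun x => map_smul _ c (ξ x)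

theorem wedgeForm_pow_apply (s : ℕ) (ξ : Form (2 * n) M) (x : M) :
    (σ.wedgeForm ^ s) ξ x = (LinearMap.mulLeft ℝ (σ.form x) ^ s) (ξ x) := by
  induction s with
  | zero => rfl
  | succ s ih =>
    rw [pow_succ', Module.End.mul_apply, pow_succ', Module.End.mul_apply, ← ih]
    rfl

theorem contractForm_pow_apply (s : ℕ) (ξ : Form (2 * n) M) (x : M) :
    (σ.contractForm ^ s) ξ x = (dualLefschetz (σ.form x) (σ.flatEquiv x) ^ s) (ξ x) := by
  induction s with
  | zero => rfl
  | succ s ih =>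
    rw [pow_succ', Module.End.mul_apply, pow_succ', Module.End.mul_apply, ← ih]
    rfl

theorem weylSum_form_apply (N : ℕ) (p : ℤ) (ξ : Form (2 * n) M) (x : M) :
    weylSum σ.wedgeForm σ.contractForm N p ξ x =
      weylSum (LinearMap.mulLeft ℝ (σ.form x)) (dualLefschetz (σ.form x) (σ.flatEquiv x)) N p
        (ξ x) := by
  rw [weylSum_apply, weylSum_apply, Finset.sum_apply]
  refine Finset.sum_congr rfl fun r _ => ?_
  have hΛ : divPow σ.contractForm r ξ x =
      divPow (dualLefschetz (σ.form x) (σ.flatEquiv x)) r (ξ x) := by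
    simp only [divPow_natCast, LinearMap.smul_apply, Pi.smul_apply, contractForm_pow_apply]
  rw [Pi.smul_apply, ← hΛ]
  congr 1
  generalize divPow σ.contractForm r ξ = η
  rcases lt_or_ge (p + r) 0 with h | h
  · rw [divPow_of_neg _ h, divPow_of_neg _ h]
    rfl
  · obtain ⟨t, ht⟩ := Int.eq_ofNat_of_zero_le h
    rw [ht]
    simp only [divPow_natCast, LinearMap.smul_apply, Pi.smul_apply, wedgeForm_pow_apply]

theorem symplecticStar_apply (ξ : Form (2 * n) M) (x : M) :
    σ.symplecticStar ξ x = linearStar n (σ.form x) (σ.flatEquiv x) (ξ x) := rfl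

theorem symplecticStar_smul (c : ℝ) (ξ : Form (2 * n) M) :
    σ.symplecticStar (c • ξ) = c • σ.symplecticStar ξ :=
  funext fun x => IsSymplectic.linearStar_smul n c (ξ x)

theorem symplecticStar_eq_weylSum {k N : ℕ} (hN : k < 2 * N) {ξ : Form (2 * n) M}
    (hξ : ∀ x, ξ x ∈ ⋀[ℝ]^k (Dual ℝ (TangentSpace (𝓡 (2 * n)) x))) :
    σ.symplecticStar ξ =
      starSign k • weylSum σ.wedgeForm σ.contractForm (N + 1) (n - k) ξ := by
  funext x
  rw [symplecticStar_apply, (σ.isSymplectic x).linearStar_eq_weylSum n (finrank_tangentSpace x)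
    N hN (hξ x), Pi.smul_apply, weylSum_form_apply]

theorem symplecticStar_symplecticStar {k : ℕ} {ξ : Form (2 * n) M}
    (hξ : ∀ x, ξ x ∈ ⋀[ℝ]^k (Dual ℝ (TangentSpace (𝓡 (2 * n)) x))) :
    σ.symplecticStar (σ.symplecticStar ξ) = ξ :=
  funext fun x => (σ.isSymplectic x).linearStar_linearStar n (finrank_tangentSpace x) (hξ x)

theorem contractForm_eq_pullback {γ : M → M} {ξ : Form (2 * n) M} {x : M}
    (hσ : σ.form x = pullback (mfderiv (𝓡 (2 * n)) (𝓡 (2 * n)) γ x).toLinearMap (σ.form (γ x)))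
    (hξ : ξ x = pullback (mfderiv (𝓡 (2 * n)) (𝓡 (2 * n)) γ x).toLinearMap (ξ (γ x))) :
    σ.contractForm ξ x =
      pullback (mfderiv (𝓡 (2 * n)) (𝓡 (2 * n)) γ x).toLinearMap (σ.contractForm ξ (γ x)) := by
  set A := (mfderiv (𝓡 (2 * n)) (𝓡 (2 * n)) γ x).toLinearMap with hA
  -- A kernel vector of the differential would lie in the kernel of `σ_x = γ^* σ_{γ x}`, which is
  -- nondegenerate. By dimension the differential is then an isomorphism, as naturality of `Λ`
  -- requires.
  have hinj : Function.Injective A := by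
    rw [← LinearMap.ker_eq_bot, LinearMap.ker_eq_bot']
    intro v hv
    have h1 := (σ.isSymplectic x).ι_apply v
    rw [hσ, interiorProduct_pullback, hv, map_zero, LinearMap.zero_apply, map_zero,
      ExteriorAlgebra.ι_eq_zero_iff] at h1
    exact (σ.flatEquiv x).map_eq_zero_iff.1 h1
  let B := LinearEquiv.ofInjectiveOfFinrankEq A hinj
    ((finrank_tangentSpace x).trans (finrank_tangentSpace (γ x)).symm)
  have hB : B.toLinearMap = A := rfl
  have h2 : IsSymplectic (pullback B.toLinearMap (σ.form (γ x))) (σ.flatEquiv x) := by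
    rw [hB, ← hσ]
    exact σ.isSymplectic x
  have h3 := (σ.isSymplectic (γ x)).pullback_dualLefschetz B h2 (ξ (γ x))
  rw [hB, ← hσ, ← hξ] at h3
  exact h3.symm

variable [IsManifold (𝓡 (2 * n)) ∞ M]

theorem isSmooth_contractForm {ξ : Form (2 * n) M} (hξ : IsSmooth ξ) :
    IsSmooth (σ.contractForm ξ) := fun x₀ => by
  have key (y : EuclideanSpace ℝ (Fin (2 * n))) : ∃ e : EuclideanSpace ℝ (Fin (2 * n)) ≃ₗ[ℝ]
      Dual ℝ (EuclideanSpace ℝ (Fin (2 * n))), y ∈ (extChartAt (𝓡 (2 * n)) x₀).target →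
        IsSymplectic (inChart x₀ σ.form y) e ∧ inChart x₀ (σ.contractForm ξ) y =
          dualLefschetz (inChart x₀ σ.form y) e (inChart x₀ ξ y) := by
    by_cases hy : y ∈ (extChartAt (𝓡 (2 * n)) x₀).target
    · let B := LinearEquiv.ofInjectiveOfFinrankEq (chartSymmDeriv x₀ y)
        (chartSymmDeriv_injective hy) (finrank_euclideanSpace_fin.trans (finrank_tangentSpace _).symm)
      have h := (σ.isSymplectic ((extChartAt (𝓡 (2 * n)) x₀).symm y)).pullback B
      exact ⟨_, fun _ => ⟨h, (σ.isSymplectic _).pullback_dualLefschetz B h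
        (ξ ((extChartAt (𝓡 (2 * n)) x₀).symm y))⟩⟩
    -- Outside the chart target any isomorphism will do.
    · exact ⟨(EuclideanSpace.basisFun (Fin (2 * n)) ℝ).toBasis.toDualEquiv, fun h => (hy h).elim⟩
  choose e he using key
  exact (SmoothFormOn.dualLefschetz (σ.mem_closedForms.1.2.1 x₀) (hξ x₀)
    fun y hy => (he y hy).1).congr fun y hy => (he y hy).2

end SymplecticForm

/-! ### The graded space of invariant forms -/

/-- The spaces `Ω^k_Γ(M)`, zero for `k < 0`. -/
def invariantGrade (m : ℕ) {M : Type*} [TopologicalSpace M]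
    [ChartedSpace (EuclideanSpace ℝ (Fin m)) M] (Γ : StructureGroupoid M) (k : ℤ) :
    Submodule ℝ (Form m M) :=
  if 0 ≤ k then invariantForms Γ k.toNat else ⊥

section InvariantGrade

variable {m : ℕ} {M : Type*} [TopologicalSpace M] [ChartedSpace (EuclideanSpace ℝ (Fin m)) M]
  {Γ : StructureGroupoid M}

theorem invariantGrade_natCast (k : ℕ) : invariantGrade m Γ k = invariantForms Γ k := by
  simp [invariantGrade]

theorem invariantGrade_of_neg {k : ℤ} (hk : k < 0) : invariantGrade m Γ k = ⊥ := if_neg (by omega)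

theorem mem_invariantGrade {k : ℤ} {ξ : Form m M} : ξ ∈ invariantGrade m Γ k ↔
    (∀ x, ξ x ∈ extGrade (Dual ℝ (TangentSpace (𝓡 m) x)) k) ∧ IsSmooth ξ ∧
      ∀ γ ∈ Γ, ∀ x ∈ γ.source,
        ξ x = pullback (mfderiv (𝓡 m) (𝓡 m) γ x).toLinearMap (ξ (γ x)) := by
  rcases lt_or_ge k 0 with hk | hk
  · rw [invariantGrade_of_neg hk, Submodule.mem_bot]
    constructor
    · rintro rfl
      exact ⟨fun x => zero_mem _, isSmooth_zero, fun _ _ _ _ => (map_zero _).symm⟩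
    · intro h
      funext x
      have := h.1 x
      rwa [extGrade_of_neg hk, Submodule.mem_bot] at this
  · lift k to ℕ using hk
    rw [invariantGrade_natCast]
    simp only [extGrade_natCast]
    rfl

/-- Additivity of `extDerivForm` is available only for smooth forms, whereas a Lefschetz complex
needs an endomorphism of the whole space. The values of the extension on other forms play no role.
-/
theorem exists_linear_extDerivForm :
    ∃ D : End ℝ (Form m M), ∀ ξ, IsSmooth ξ → D ξ = extDerivForm ξ := by
  let S : Submodule ℝ (Form m M) :=
    { carrier := {ξ | IsSmooth ξ}
      zero_mem' := isSmooth_zero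
      add_mem' := fun {ξ η} hξ hη x₀ => inChart_add x₀ ξ η ▸ (hξ x₀).add (hη x₀)
      smul_mem' := fun c ξ hξ x₀ => inChart_smul x₀ c ξ ▸ (hξ x₀).const_smul c }
  let d : S →ₗ[ℝ] Form m M :=
    { toFun := fun ξ => extDerivForm ξ.1
      map_add' := fun ξ η => extDerivForm_add ξ.2 η.2
      map_smul' := fun c ξ => extDerivForm_smul c ξ.2 }
  obtain ⟨D, hD⟩ := LinearMap.exists_extend d
  exact ⟨D, fun ξ hξ => LinearMap.congr_fun hD ⟨ξ, hξ⟩⟩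

theorem mem_exactForms {D : End ℝ (Form m M)} (hD : ∀ ξ, IsSmooth ξ → D ξ = extDerivForm ξ)
    {k : ℕ} {ξ : Form m M} :
    ξ ∈ exactForms Γ k ↔ ξ ∈ (invariantGrade m Γ (k - 1)).map D := by
  cases k with
  | zero => rw [invariantGrade_of_neg (by simp), Submodule.map_bot]; rfl
  | succ k =>
    rw [show ((k + 1 : ℕ) : ℤ) - 1 = k by push_cast; ring, invariantGrade_natCast]
    exact exists_congr fun η => and_congr_right fun hη => by rw [hD η hη.2.1]

theorem mem_closedForms_iff {D : End ℝ (Form m M)} (hD : ∀ ξ, IsSmooth ξ → D ξ = extDerivForm ξ)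
    {k : ℕ} {ξ : Form m M} :
    ξ ∈ closedForms Γ k ↔ ξ ∈ invariantGrade m Γ k ∧ D ξ = 0 := by
  rw [invariantGrade_natCast]
  exact and_congr_right fun h => by rw [hD ξ h.2.1]

theorem cohomologyClass_eq_iff {k : ℕ} {ξ η : closedForms (m := m) Γ k} :
    cohomologyClass Γ k ξ = cohomologyClass Γ k η ↔ (ξ - η : Form m M) ∈ exactForms Γ k :=
  Submodule.Quotient.eq _

end InvariantGrade

/-! ### Invariant forms as a Lefschetz complex; cohomology in terms of forms -/

namespace SymplecticForm

variable {n : ℕ} {M : Type*} [TopologicalSpace M]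
  [ChartedSpace (EuclideanSpace ℝ (Fin (2 * n))) M] [IsManifold (𝓡 (2 * n)) ∞ M]
  {Γ : StructureGroupoid M} (σ : SymplecticForm n Γ)
  {D : End ℝ (Form (2 * n) M)}

theorem isLefschetzComplex (hΓ : ∀ γ ∈ Γ, ContMDiffOn (𝓡 (2 * n)) (𝓡 (2 * n)) ∞ γ γ.source)
    (hD : ∀ ξ, IsSmooth ξ → D ξ = extDerivForm ξ) :
    IsLefschetzComplex n σ.wedgeForm σ.contractForm D (invariantGrade (2 * n) Γ) where
  L_mem {k ξ} hξ := by
    obtain ⟨h1, h2, h3⟩ := mem_invariantGrade.1 hξ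
    obtain ⟨s1, s2, s3⟩ := σ.mem_closedForms.1
    refine mem_invariantGrade.2 ⟨fun x => mul_mem_extGrade (s1 x) (h1 x),
      fun x₀ => inChart_mul x₀ σ.form ξ ▸ (s2 x₀).mul (h2 x₀), fun γ hγ x hx => ?_⟩
    have : σ.wedgeForm ξ = σ.form * ξ := rfl
    simp only [this, Pi.mul_apply, map_mul]
    exact congrArg₂ _ (s3 γ hγ x hx) (h3 γ hγ x hx)
  Λ_mem {k ξ} hξ := by
    obtain ⟨h1, h2, h3⟩ := mem_invariantGrade.1 hξ
    exact mem_invariantGrade.2 ⟨fun x => ((σ.isSymplectic x).isLefschetzModule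
      (finrank_tangentSpace x)).Λ_mem (h1 x), σ.isSmooth_contractForm h2, fun γ hγ x hx =>
      σ.contractForm_eq_pullback (σ.mem_closedForms.1.2.2 γ hγ x hx) (h3 γ hγ x hx)⟩
  comm {k ξ} hξ := funext fun x => ((σ.isSymplectic x).isLefschetzModule
      (finrank_tangentSpace x)).comm ((mem_invariantGrade.1 hξ).1 x)
  eq_zero_of_neg hk hξ := by
    rwa [invariantGrade_of_neg hk, Submodule.mem_bot] at hξ
  eq_zero_of_lt hk hξ := funext fun x => ((σ.isSymplectic x).isLefschetzModule
      (finrank_tangentSpace x)).eq_zero_of_lt hk ((mem_invariantGrade.1 hξ).1 x)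
  d_mem {k ξ} hξ := by
    rw [hD ξ (mem_invariantGrade.1 hξ).2.1]
    rcases lt_or_ge k 0 with hk | hk
    · rw [invariantGrade_of_neg hk, Submodule.mem_bot] at hξ
      rw [hξ, extDerivForm_zero]
      exact zero_mem _
    lift k to ℕ using hk
    rw [invariantGrade_natCast] at hξ
    rw [← Nat.cast_succ, invariantGrade_natCast]
    exact extDerivForm_mem_invariantForms hΓ hξ
  d_L {k ξ} hξ := by
    have h2 := (mem_invariantGrade.1 hξ).2.1
    have h3 : IsSmooth (σ.form * ξ) := fun x₀ =>
      inChart_mul x₀ σ.form ξ ▸ (σ.mem_closedForms.1.2.1 x₀).mul (h2 x₀)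
    exact (hD _ h3).trans ((σ.extDerivForm_wedge h2).trans (by rw [hD ξ h2]; rfl))
  d_d {k ξ} hξ := by
    have h2 := (mem_invariantGrade.1 hξ).2.1
    rw [hD ξ h2, hD _ h2.extDerivForm, extDerivForm_extDerivForm h2]

set_option maxHeartbeats 2000000 in
/-- On closed forms the codifferential is a nonzero multiple of `d Λ`. -/
theorem exists_codiff_eq_smul
    (hΓ : ∀ γ ∈ Γ, ContMDiffOn (𝓡 (2 * n)) (𝓡 (2 * n)) ∞ γ γ.source)
    (hD : ∀ ξ, IsSmooth ξ → D ξ = extDerivForm ξ) {k : ℕ} {ξ : Form (2 * n) M}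
    (hξ : ξ ∈ invariantForms Γ k) (hdξ : D ξ = 0) :
    ∃ c : ℝ, c ≠ 0 ∧ σ.codiff k ξ = c • D (σ.contractForm ξ) := by
  have hA := σ.isLefschetzComplex hΓ hD
  have hξA : ξ ∈ invariantGrade (2 * n) Γ k := by rwa [invariantGrade_natCast]
  have hη := hA.d_mem (hA.Λ_mem hξA)
  have hstar := σ.symplecticStar_eq_weylSum (N := k + 1) (by omega) hξ.1
  -- This supplies the smoothness of `⋆ξ`, without which `D` could not replace the exterior
  -- derivative.
  have hW : weylSum σ.wedgeForm σ.contractForm (k + 1 + 1) (n - k) ξ ∈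
      invariantGrade (2 * n) Γ (k + 2 * (n - k)) := by
    rw [weylSum_apply]
    refine sum_mem fun r _ => Submodule.smul_mem _ _ ?_
    have := hA.divPow_L_mem (n - k + r)
      (Submodule.smul_mem _ (r.factorial : ℝ)⁻¹ (hA.Λ_pow_mem r hξA))
    rwa [show (k : ℤ) - 2 * r + 2 * (n - k + r) = k + 2 * (n - k) by ring] at this
  have hd : extDerivForm (σ.symplecticStar ξ) = -starSign k •
      weylSum σ.wedgeForm σ.contractForm (k + 1 + 1) (n - k + 1) (D (σ.contractForm ξ)) := by
    rw [← hD _ (hstar ▸ (mem_invariantGrade.1 (Submodule.smul_mem _ _ hW)).2.1), hstar, map_smul,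
      hA.d_weylSum (k + 1) _ (by push_cast; omega) hξA hdξ, smul_neg, neg_smul]
  rw [codiff, hd]
  cases k with
  | zero =>
    -- For `k = 0` the form `d Λ ξ` has degree `-1`, so both sides vanish and any constant serves.
    have h0 : D (σ.contractForm ξ) = 0 := hA.eq_zero_of_neg (by norm_num) hη
    exact ⟨1, one_ne_zero, by
      rw [h0, map_zero, smul_zero, smul_zero, ← zero_smul ℝ (0 : Form (2 * n) M),
        symplecticStar_smul, zero_smul, smul_zero, zero_smul]⟩
  | succ j =>
    rw [show ((j + 1 : ℕ) : ℤ) - 2 + 1 = j by push_cast; ring, invariantGrade_natCast] at hη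
    have h1 := σ.symplecticStar_eq_weylSum (N := j + 1 + 1) (by omega) hη.1
    -- The exponent shift in `d_weylSum` matches the drop in degree: `n - k + 1 = n - (k - 1)`. The
    -- sum is thus again a multiple of `⋆`, and the outer star cancels it.
    have h2 : weylSum σ.wedgeForm σ.contractForm (j + 1 + 1 + 1) (n - j) (D (σ.contractForm ξ)) =
        (starSign j)⁻¹ • σ.symplecticStar (D (σ.contractForm ξ)) := by
      rw [h1, smul_smul, inv_mul_cancel₀ (starSign_ne_zero j), one_smul]
    rw [show (n : ℤ) - (j + 1 : ℕ) + 1 = n - j by push_cast; ring, h2, symplecticStar_smul,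
      symplecticStar_smul, σ.symplecticStar_symplecticStar hη.1, smul_smul, smul_smul]
    exact ⟨_, mul_ne_zero (mul_ne_zero (pow_ne_zero _ (by norm_num))
      (neg_ne_zero.2 (starSign_ne_zero _))) (inv_ne_zero (starSign_ne_zero j)), rfl⟩

theorem isHarmonic_iff (hΓ : ∀ γ ∈ Γ, ContMDiffOn (𝓡 (2 * n)) (𝓡 (2 * n)) ∞ γ γ.source)
    (hD : ∀ ξ, IsSmooth ξ → D ξ = extDerivForm ξ) {k : ℕ} {ξ : Form (2 * n) M} :
    σ.IsHarmonic k ξ ↔ ξ ∈ harmonicPart σ.contractForm D (invariantGrade (2 * n) Γ) k := by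
  rw [mem_harmonicPart, invariantGrade_natCast, IsHarmonic]
  refine and_congr_right fun hξ => ?_
  rw [← hD ξ hξ.2.1]
  refine and_congr_right fun hdξ => ?_
  obtain ⟨c, hc, h⟩ := σ.exists_codiff_eq_smul hΓ hD hξ hdξ
  rw [h, smul_eq_zero, or_iff_right hc]

theorem lefschetzIter_cohomologyClass (p s : ℕ) (ξ : closedForms (m := 2 * n) Γ p) :
    ∃ ζ : closedForms (m := 2 * n) Γ (p + 2 * s), (ζ : Form (2 * n) M) = (σ.wedgeForm ^ s) ξ ∧
      σ.lefschetzIter p s (cohomologyClass Γ p ξ) = cohomologyClass Γ _ ζ := by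
  induction s with
  | zero => exact ⟨ξ, rfl, rfl⟩
  | succ s ih =>
    obtain ⟨ζ, h1, h2⟩ := ih
    refine ⟨σ.wedgeClosed _ ζ, ?_, congrArg (σ.lefschetz _) h2⟩
    rw [pow_succ', Module.End.mul_apply, ← h1]
    rfl

theorem lefschetzPow_cohomologyClass {p q : ℕ} (s : ℕ) (h : p + 2 * s = q)
    (ξ : closedForms (m := 2 * n) Γ p) :
    ∃ ζ : closedForms (m := 2 * n) Γ q, (ζ : Form (2 * n) M) = (σ.wedgeForm ^ s) ξ ∧
      σ.lefschetzPow s h (cohomologyClass Γ p ξ) = cohomologyClass Γ q ζ := by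
  subst h
  exact σ.lefschetzIter_cohomologyClass p s ξ

set_option maxHeartbeats 2000000 in
/-- Surjectivity of `L^s` on cohomology in terms of forms. -/
theorem surjective_lefschetzPow_iff (hD : ∀ ξ, IsSmooth ξ → D ξ = extDerivForm ξ) {s : ℕ}
    (h : n - s + 2 * s = n + s) :
    Function.Surjective (σ.lefschetzPow (p := n - s) (q := n + s) s h) ↔
      ∀ ξ ∈ invariantGrade (2 * n) Γ (n + s), D ξ = 0 →
        ∃ η ∈ invariantGrade (2 * n) Γ (n - s), D η = 0 ∧
          (σ.wedgeForm ^ s) η - ξ ∈ (invariantGrade (2 * n) Γ (n + s - 1)).map D := by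
  have e1 : (n : ℤ) + s = (n + s : ℕ) := by push_cast; rfl
  have e2 : (n : ℤ) - s = (n - s : ℕ) := by omega
  rw [e1, e2]
  constructor
  · intro H ξ hξ hdξ
    obtain ⟨c, hc⟩ := H (cohomologyClass Γ _ ⟨ξ, (mem_closedForms_iff hD).2 ⟨hξ, hdξ⟩⟩)
    obtain ⟨η, rfl⟩ := Submodule.Quotient.mk_surjective _ c
    obtain ⟨ζ, h1, h2⟩ := σ.lefschetzPow_cohomologyClass s h η
    obtain ⟨hη, hdη⟩ := (mem_closedForms_iff hD).1 η.2
    refine ⟨η, hη, hdη, ?_⟩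
    rw [← h1, ← mem_exactForms hD]
    exact cohomologyClass_eq_iff.1 (h2.symm.trans hc)
  · intro H c
    obtain ⟨ξ, rfl⟩ := Submodule.Quotient.mk_surjective _ c
    obtain ⟨hξ, hdξ⟩ := (mem_closedForms_iff hD).1 ξ.2
    obtain ⟨η, hη, hdη, hηξ⟩ := H ξ hξ hdξ
    obtain ⟨ζ, h1, h2⟩ := σ.lefschetzPow_cohomologyClass s h
      ⟨η, (mem_closedForms_iff hD).2 ⟨hη, hdη⟩⟩
    refine ⟨_, h2.trans (cohomologyClass_eq_iff.2 ?_)⟩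
    rw [h1, mem_exactForms hD]
    exact hηξ

/-- Existence of harmonic representatives in terms of forms. -/
theorem exists_harmonic_representative_iff
    (hΓ : ∀ γ ∈ Γ, ContMDiffOn (𝓡 (2 * n)) (𝓡 (2 * n)) ∞ γ γ.source)
    (hD : ∀ ξ, IsSmooth ξ → D ξ = extDerivForm ξ) (k : ℕ) :
    (∀ c : Cohomology (2 * n) Γ k, ∃ ξ : closedForms (m := 2 * n) Γ k,
        σ.IsHarmonic k ξ ∧ cohomologyClass Γ k ξ = c) ↔
      ∀ ξ ∈ invariantGrade (2 * n) Γ k, D ξ = 0 →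
        ∃ η ∈ harmonicPart σ.contractForm D (invariantGrade (2 * n) Γ) k,
          η - ξ ∈ (invariantGrade (2 * n) Γ (k - 1)).map D := by
  constructor
  · intro H ξ hξ hdξ
    obtain ⟨η, h1, h2⟩ := H (cohomologyClass Γ _ ⟨ξ, (mem_closedForms_iff hD).2 ⟨hξ, hdξ⟩⟩)
    exact ⟨η, (σ.isHarmonic_iff hΓ hD).1 h1,
      (mem_exactForms hD).1 (cohomologyClass_eq_iff.1 h2)⟩
  · intro H c
    obtain ⟨ξ, rfl⟩ := Submodule.Quotient.mk_surjective _ c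
    obtain ⟨hξ, hdξ⟩ := (mem_closedForms_iff hD).1 ξ.2
    obtain ⟨η, h1, h2⟩ := H ξ hξ hdξ
    obtain ⟨h3, h4, -⟩ := mem_harmonicPart.1 h1
    exact ⟨⟨η, (mem_closedForms_iff hD).2 ⟨h3, h4⟩⟩, (σ.isHarmonic_iff hΓ hD).2 h1,
      cohomologyClass_eq_iff.2 ((mem_exactForms hD).2 h2)⟩

end SymplecticForm

end InvariantForms

end

/-- For a pseudogroup `Γ` of local diffeomorphisms of a `2n`-dimensional manifold `M` and a
`Γ`-invariant symplectic form, every invariant cohomology class has a harmonic representative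
if and only if `L^k : H^{n-k}_Γ(M) → H^{n+k}_Γ(M)` is surjective for `0 ≤ k ≤ n`. -/
theorem mainTheorem3 (n : ℕ) (M : Type*) [TopologicalSpace M]
    [ChartedSpace (EuclideanSpace ℝ (Fin (2 * n))) M] [IsManifold (𝓡 (2 * n)) ∞ M]
    (Γ : StructureGroupoid M) [ClosedUnderRestriction Γ]
    (hΓ : ∀ γ ∈ Γ, ContMDiffOn (𝓡 (2 * n)) (𝓡 (2 * n)) ∞ γ γ.source)
    (σ : InvariantForms.SymplecticForm n Γ) :
    (∀ (k : ℕ) (c : InvariantForms.Cohomology (2 * n) Γ k),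
      ∃ ξ : InvariantForms.closedForms (m := 2 * n) Γ k,
        σ.IsHarmonic k ξ ∧ InvariantForms.cohomologyClass Γ k ξ = c) ↔
    ∀ (k : ℕ) (hk : k ≤ n), Function.Surjective
      (σ.lefschetzPow (p := n - k) (q := n + k) k (by omega)) := by
  -- Both conditions are translated into statements about `D`, `L` and `Λ` on forms and then follow
  -- from the algebra of Lefschetz complexes.
  obtain ⟨D, hD⟩ := InvariantForms.exists_linear_extDerivForm (m := 2 * n) (M := M)
  have hA := σ.isLefschetzComplex hΓ hD
  constructor
  · intro H k hk
    rw [σ.surjective_lefschetzPow_iff hD]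
    intro ξ hξ hdξ
    have h := (σ.exists_harmonic_representative_iff hΓ hD (n + k)).1 (H (n + k))
    push_cast at h
    exact hA.exists_L_pow_sub_mem_of_harmonic (h ξ hξ hdξ)
  · intro H k
    rw [σ.exists_harmonic_representative_iff hΓ hD]
    intro ξ hξ hdξ
    exact hA.exists_harmonic_of_surjective
      (fun s hs => (σ.surjective_lefschetzPow_iff hD _).1 (H s hs)) hξ hdξ
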